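/- Let $K$ be a field, $S$ an inverse monoid with set of idempotents $E(S)$, and $A$ a unital associative $K$-algebra. Let $\theta$ be a unital action of $S$ on $A$, i.e. a homomorphism $s\mapsto\theta_s$ from $S$ to the inverse monoid of partial bijections of $A$ such that $\theta_1=\mathrm{id}_A$ and each $\theta_s$ is an isomorphism of $K$-algebras between ideals of $A$ whose range is $1_sA$ for some central idempotent $1_s\in A$ (its domain is then $1_{s^{-1}}A$). Let $L=\bigoplus_{s\in S}1_sA\,\delta_s$ be the algebra with product $a\delta_s\cdot b\delta_t=a\,\theta_s(1_{s^{-1}}b)\,\delta_{st}$, and let $A\rtimes_\theta S$ be the quotient of $L$ by the two-sided ideal generated by all $a\delta_s-a\delta_t$ with $a\in 1_sA$ and $s\le t$, where $s\le t$ means $s=et$ for some $e\in E(S)$. Write $\overline{x}$ for the class of $x\in L$. Let $M$ be an $A\rtimes_\theta S$-bimodule on which the two induced actions of $K$ agree. Put $$M^A=\{x\in M:\ \overline{a\delta_1}\,x=x\,\overline{a\delta_1}\ \text{ for all } a\in A\};$$ this is a left module over the semigroup algebra $KS$ via $s\cdot x=\overline{1_s\delta_s}\,x\,\overline{1_{s^{-1}}\delta_{s^{-1}}}$.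 For a left $KS$-module $V$ let $H^n(S,V)=\mathrm{Ext}^n_{KS}(KE(S),V)$, where $KE(S)$ is the $K$-vector space with basis $E(S)$ and $s\cdot e=ses^{-1}$. For a $K$-algebra $R$ and an $R$-bimodule $N$ let $H^n(R,N)=\mathrm{Ext}^n_{R\otimes_K R^{\mathrm{op}}}(R,N)$ be the Hochschild cohomology. If $A$ is separable over $K$, i.e. projective as a left $A\otimes_K A^{\mathrm{op}}$-module, then for every such $M$ and every integer $n\ge 0$ there is an isomorphism of $K$-vector spaces $$H^n(S,M^A)\;\cong\; H^n(A\rtimes_\theta S,\,M).$$ -/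

import Mathlib

open scoped TensorProduct

universe u

/-! ### Inverse monoids -/

/-- An inverse monoid: every `s` has a unique `s⁻¹` with `s s⁻¹ s = s` and `s⁻¹ s s⁻¹ = s⁻¹`. -/
class InverseMonoid (S : Type*) extends Monoid S, Inv S where
  mul_inv_mul : ∀ s : S, s * s⁻¹ * s = s
  inv_mul_inv : ∀ s : S, s⁻¹ * s * s⁻¹ = s⁻¹
  inv_unique : ∀ s t : S, s * t * s = s → t * s * t = t → t = s⁻¹

namespace InverseMonoid

variable {S : Type*} [InverseMonoid S]

theorem inv_inv' (s : S) : s⁻¹⁻¹ = s :=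
  (inv_unique s⁻¹ s (inv_mul_inv s) (mul_inv_mul s)).symm

theorem inv_of_idem {e : S} (he : IsIdempotentElem e) : e⁻¹ = e := by
  have h : e * e * e = e := by rw [he.eq, he.eq]
  exact (inv_unique e e h h).symm

theorem idem_mul {e f : S} (he : IsIdempotentElem e) (hf : IsIdempotentElem f) :
    IsIdempotentElem (e * f) := by
  have he' : ∀ x, e * (e * x) = e * x := fun x => by rw [← mul_assoc, he.eq]
  have hf' : ∀ x, f * (f * x) = f * x := fun x => by rw [← mul_assoc, hf.eq]
  have h1 := mul_inv_mul (e * f)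
  have h2 := inv_mul_inv (e * f)
  set x := (e * f)⁻¹ with hx
  have h2' : x * (e * (f * x)) = x := by simpa [mul_assoc] using h2
  have h2'' : ∀ y, x * (e * (f * (x * y))) = x * y := fun y => by
    conv_rhs => rw [← h2']
    simp [mul_assoc]
  have hfx : f * x * e = x := by
    refine inv_unique (e * f) (f * x * e) ?_ ?_
    · simpa [mul_assoc, he', hf'] using h1
    · simp [mul_assoc, he', hf', h2'']
  have hxx : IsIdempotentElem x := by
    have : (f * x * e) * (f * x * e) = f * x * e := by
      simp [mul_assoc, h2'']
    rwa [hfx] at this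
  have : e * f = x := by
    rw [← inv_of_idem hxx, hx, inv_inv']
  rwa [this]

theorem idem_comm {e f : S} (he : IsIdempotentElem e) (hf : IsIdempotentElem f) :
    e * f = f * e := by
  have he' : ∀ x, e * (e * x) = e * x := fun x => by rw [← mul_assoc, he.eq]
  have hf' : ∀ x, f * (f * x) = f * x := fun x => by rw [← mul_assoc, hf.eq]
  have hef := idem_mul he hf
  have hfe := idem_mul hf he
  have h : f * e = (e * f)⁻¹ := by
    refine inv_unique _ _ ?_ ?_
    · have := hef.eq
      simp only [mul_assoc, he', hf'] at this ⊢
      exact this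
    · have := hfe.eq
      simp only [mul_assoc, he', hf'] at this ⊢
      exact this
  rw [h, inv_of_idem hef]

theorem idem_inv_mul (s : S) : IsIdempotentElem (s⁻¹ * s) := by
  change s⁻¹ * s * (s⁻¹ * s) = s⁻¹ * s
  rw [← mul_assoc, inv_mul_inv]

theorem idem_mul_inv (s : S) : IsIdempotentElem (s * s⁻¹) := by
  change s * s⁻¹ * (s * s⁻¹) = s * s⁻¹
  rw [← mul_assoc, mul_inv_mul]

theorem mul_inv_rev' (s t : S) : (s * t)⁻¹ = t⁻¹ * s⁻¹ := by
  have hc := idem_comm (idem_mul_inv t) (idem_inv_mul s)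
  refine (inv_unique (s * t) (t⁻¹ * s⁻¹) ?_ ?_).symm
  · calc s * t * (t⁻¹ * s⁻¹) * (s * t) = s * ((t * t⁻¹) * (s⁻¹ * s)) * t := by simp [mul_assoc]
      _ = (s * s⁻¹ * s) * (t * t⁻¹ * t) := by rw [hc]; simp [mul_assoc]
      _ = s * t := by rw [mul_inv_mul, mul_inv_mul]
  · calc t⁻¹ * s⁻¹ * (s * t) * (t⁻¹ * s⁻¹) = t⁻¹ * ((s⁻¹ * s) * (t * t⁻¹)) * s⁻¹ := by
          simp [mul_assoc]
      _ = (t⁻¹ * t * t⁻¹) * (s⁻¹ * s * s⁻¹) := by rw [← hc]; simp [mul_assoc]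
      _ = t⁻¹ * s⁻¹ := by rw [inv_mul_inv, inv_mul_inv]

theorem inv_one' : (1 : S)⁻¹ = 1 := inv_of_idem (one_mul 1)

theorem idem_conj (s : S) {e : S} (he : IsIdempotentElem e) : IsIdempotentElem (s * e * s⁻¹) := by
  have hc := idem_comm he (idem_inv_mul s)
  change s * e * s⁻¹ * (s * e * s⁻¹) = s * e * s⁻¹
  calc s * e * s⁻¹ * (s * e * s⁻¹) = s * (e * (s⁻¹ * s)) * e * s⁻¹ := by simp [mul_assoc]
    _ = (s * s⁻¹ * s) * (e * e) * s⁻¹ := by rw [hc]; simp [mul_assoc]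
    _ = s * e * s⁻¹ := by rw [mul_inv_mul, he.eq]

/-- The natural partial order: `s ≤ t` iff `s = e t` for some idempotent `e`. -/
def NatLE (s t : S) : Prop := ∃ e : S, IsIdempotentElem e ∧ s = e * t

variable (S) in
/-- The set `E(S)` of idempotents of `S`. -/
abbrev Idem : Type _ := {e : S // IsIdempotentElem e}

/-- The idempotent `s e s⁻¹`. -/
def conjIdem (s : S) (e : Idem S) : Idem S := ⟨s * e.1 * s⁻¹, idem_conj s e.2⟩

variable (S) in
/-- The trivial module `K E(S)`: the free `K`-module on `E(S)` with `s · e = s e s⁻¹`. -/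
noncomputable def idemRep (K : Type*) [CommRing K] : Representation K S (Idem S →₀ K) where
  toFun s := Finsupp.lmapDomain K K (conjIdem s)
  map_one' := by
    refine Finsupp.lhom_ext fun e k => ?_
    have : conjIdem (1 : S) e = e := Subtype.ext (by simp [conjIdem, inv_one'])
    simp [Finsupp.mapDomain_single, this]
  map_mul' s t := by
    refine Finsupp.lhom_ext fun e k => ?_
    have : conjIdem (s * t) e = conjIdem s (conjIdem t e) :=
      Subtype.ext (by simp [conjIdem, mul_inv_rev', mul_assoc])
    simp [Finsupp.mapDomain_single, this]

/-- `K E(S)` as a left module over the semigroup algebra `K S`. -/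
noncomputable instance idemModule (K : Type*) [CommRing K] :
    Module (MonoidAlgebra K S) (Idem S →₀ K) :=
  Module.compHom _ (idemRep S K).asAlgebraHom.toRingHom

/-- The cohomology of an inverse monoid `S` with values in a left `K S`-module `V`:
`Hⁿ(S, V) = Extⁿ_{K S}(K E(S), V)`, as a `K`-vector space. -/
noncomputable def cohomology (K S V : Type u) [Field K] [InverseMonoid S] [AddCommGroup V]
    [Module (MonoidAlgebra K S) V] (n : ℕ) : ModuleCat.{u} K :=
  ((Ext K (ModuleCat.{u} (MonoidAlgebra K S)) n).obj
    (Opposite.op (ModuleCat.of (MonoidAlgebra K S) (Idem S →₀ K)))).obj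
      (ModuleCat.of (MonoidAlgebra K S) V)

end InverseMonoid

/-! ### Hochschild cohomology and separable algebras -/

/-- A `K`-algebra `A` is separable if `A` is projective as a left module over the enveloping
algebra `A ⊗ Aᵐᵒᵖ`, acting by `(a ⊗ b) · x = a x b`. -/
def IsSeparableAlgebra (K A : Type*) [CommRing K] [Ring A] [Algebra K A] : Prop :=
  letI : Module (A ⊗[K] Aᵐᵒᵖ) A := TensorProduct.Algebra.module
  Module.Projective (A ⊗[K] Aᵐᵒᵖ) A

/-- The Hochschild cohomology `Hⁿ(R, M) = Extⁿ_{Rᵉ}(R, M)` of a `K`-algebra `R` with values in an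
`R`-bimodule `M`, as a `K`-vector space. Here `Rᵉ = R ⊗ Rᵐᵒᵖ`, and a bimodule (a left `R`-module and
a left `Rᵐᵒᵖ`-module with commuting actions inducing the same action of `K`) is the left
`Rᵉ`-module with `(a ⊗ b) · x = a x b`. -/
noncomputable def hochschildCohomology (K R M : Type u) [Field K] [Ring R] [Algebra K R]
    [AddCommGroup M] [Module K M] [Module R M] [Module Rᵐᵒᵖ M] [IsScalarTower K R M]
    [IsScalarTower K Rᵐᵒᵖ M] [SMulCommClass R Rᵐᵒᵖ M] (n : ℕ) : ModuleCat.{u} K :=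
  letI : Module (R ⊗[K] Rᵐᵒᵖ) R := TensorProduct.Algebra.module
  letI : Module (R ⊗[K] Rᵐᵒᵖ) M := TensorProduct.Algebra.module
  ((Ext K (ModuleCat.{u} (R ⊗[K] Rᵐᵒᵖ)) n).obj
    (Opposite.op (ModuleCat.of (R ⊗[K] Rᵐᵒᵖ) R))).obj (ModuleCat.of (R ⊗[K] Rᵐᵒᵖ) M)

/-! ### Unital actions -/

/-- A unital action of an inverse monoid `S` on a unital `K`-algebra `A`: a homomorphism `θ` from `S`
to the symmetric inverse monoid of partial bijections of `A` with `θ 1 = id`, such that every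
`θ s` is an isomorphism of `K`-algebras onto the ideal `1_s A` generated by a central idempotent
`1_s` (`unit s`, uniquely determined as the unity of that ideal). The domain of `θ s` is then the
ideal `1_{s⁻¹} A`. -/
structure UnitalAction (K S A : Type*) [CommRing K] [InverseMonoid S] [Ring A] [Algebra K A] where
  act : S → (A ≃. A)
  act_one : act 1 = PEquiv.refl A
  act_mul : ∀ s t, act (s * t) = (act t).trans (act s)
  unit : S → A
  unit_idem : ∀ s, unit s * unit s = unit s
  unit_comm : ∀ s a, unit s * a = a * unit s
  mem_range_iff : ∀ s b, (∃ a, b ∈ act s a) ↔ ∃ c, b = unit s * c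
  map_add : ∀ s a b a' b', a' ∈ act s a → b' ∈ act s b → a' + b' ∈ act s (a + b)
  map_mul : ∀ s a b a' b', a' ∈ act s a → b' ∈ act s b → a' * b' ∈ act s (a * b)
  map_smul : ∀ s (k : K) a a', a' ∈ act s a → k • a' ∈ act s (k • a)

namespace UnitalAction

open InverseMonoid

section Basic

variable {K S A : Type*} [CommRing K] [InverseMonoid S] [Ring A] [Algebra K A]
  (θ : UnitalAction K S A)

theorem mem_range {s : S} {a b : A} (h : b ∈ θ.act s a) : θ.unit s * b = b := by
  obtain ⟨c, rfl⟩ := (θ.mem_range_iff s b).1 ⟨a, h⟩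
  rw [← mul_assoc, θ.unit_idem]

theorem mem_act_inv {s : S} {a b : A} (h : b ∈ θ.act s a) : a ∈ θ.act s⁻¹ b := by
  have h' : b ∈ θ.act (s * s⁻¹ * s) a := by rwa [mul_inv_mul]
  rw [θ.act_mul, PEquiv.mem_trans] at h'
  obtain ⟨b', hb', h'⟩ := h'
  obtain rfl : b = b' := Option.mem_unique h hb'
  rw [θ.act_mul, PEquiv.mem_trans] at h'
  obtain ⟨a', ha', h''⟩ := h'
  obtain rfl : a = a' := (θ.act s).inj h h''
  exact ha'

/-- The domain of `θ s` is `1_{s⁻¹} A`. -/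
theorem mem_dom_iff (s : S) (a : A) : (θ.act s a).isSome ↔ θ.unit s⁻¹ * a = a := by
  constructor
  · intro h
    obtain ⟨b, hb⟩ := Option.isSome_iff_exists.1 h
    exact θ.mem_range (θ.mem_act_inv hb)
  · intro h
    obtain ⟨b, hb⟩ := (θ.mem_range_iff s⁻¹ a).2 ⟨a, h.symm⟩
    have := θ.mem_act_inv hb
    rw [inv_inv'] at this
    exact Option.isSome_iff_exists.2 ⟨b, this⟩

theorem isSome_act (s : S) (a : A) : (θ.act s (θ.unit s⁻¹ * a)).isSome := by
  rw [mem_dom_iff, ← mul_assoc, θ.unit_idem]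

/-- The element `s · a = θ_s(1_{s⁻¹} a)`. -/
def app (s : S) (a : A) : A := (θ.act s (θ.unit s⁻¹ * a)).get (θ.isSome_act s a)

theorem app_mem (s : S) (a : A) : θ.app s a ∈ θ.act s (θ.unit s⁻¹ * a) := Option.get_mem _

theorem app_eq {s : S} {a b : A} (h : b ∈ θ.act s (θ.unit s⁻¹ * a)) : θ.app s a = b :=
  Option.mem_unique (θ.app_mem s a) h

theorem app_of_mem {s : S} {a b : A} (h : b ∈ θ.act s a) : θ.app s a = b := by
  refine θ.app_eq ?_
  rwa [(θ.mem_dom_iff s a).1 (Option.isSome_iff_exists.2 ⟨b, h⟩)]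

theorem unit_mul_app (s : S) (a : A) : θ.unit s * θ.app s a = θ.app s a :=
  θ.mem_range (θ.app_mem s a)

theorem app_add (s : S) (a b : A) : θ.app s (a + b) = θ.app s a + θ.app s b := by
  refine θ.app_eq ?_
  rw [mul_add]
  exact θ.map_add _ _ _ _ _ (θ.app_mem s a) (θ.app_mem s b)

theorem app_smul (s : S) (k : K) (a : A) : θ.app s (k • a) = k • θ.app s a := by
  refine θ.app_eq ?_
  rw [mul_smul_comm]
  exact θ.map_smul _ _ _ _ (θ.app_mem s a)

theorem app_mul (s : S) (a b : A) : θ.app s (a * b) = θ.app s a * θ.app s b := by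
  refine θ.app_eq ?_
  have : θ.unit s⁻¹ * (a * b) = θ.unit s⁻¹ * a * (θ.unit s⁻¹ * b) := by
    rw [mul_assoc, ← mul_assoc a, ← θ.unit_comm s⁻¹ a, mul_assoc, ← mul_assoc (θ.unit s⁻¹) (θ.unit s⁻¹),
      θ.unit_idem]
  rw [this]
  exact θ.map_mul _ _ _ _ _ (θ.app_mem s a) (θ.app_mem s b)

theorem unit_one : θ.unit 1 = 1 := by
  have h : (1 : A) ∈ θ.act 1 1 := by rw [θ.act_one]; rfl
  simpa using θ.mem_range h

theorem app_one (a : A) : θ.app 1 a = a := by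
  refine θ.app_eq ?_
  rw [θ.act_one, inv_one', unit_one, one_mul]
  rfl

theorem app_apply_one (s : S) : θ.app s 1 = θ.unit s := by
  obtain ⟨x, hx⟩ := (θ.mem_range_iff s (θ.unit s)).2 ⟨1, (mul_one _).symm⟩
  have h1 := θ.app_of_mem hx
  have h2 := θ.app_mul s 1 x
  rw [one_mul, h1, ← θ.unit_comm, unit_mul_app] at h2
  exact h2.symm

theorem app_inv_app (s : S) (a : A) : θ.app s (θ.app s⁻¹ a) = θ.unit s * a := by
  have h := θ.mem_act_inv (θ.app_mem s⁻¹ a)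
  rw [inv_inv'] at h
  exact θ.app_of_mem h

theorem app_app (s t : S) (a : A) : θ.app (s * t) a = θ.app s (θ.app t a) := by
  -- first on the unity of the domain
  have key : θ.app t (θ.unit (s * t)⁻¹) = θ.unit s⁻¹ * θ.unit t ∧
      θ.unit t⁻¹ * θ.unit (s * t)⁻¹ = θ.unit (s * t)⁻¹ := by
    obtain ⟨v, hv⟩ := (θ.mem_range_iff t (θ.unit s⁻¹ * θ.unit t)).2
      ⟨θ.unit s⁻¹, θ.unit_comm _ _⟩
    have hvdom : θ.unit (s * t)⁻¹ * v = v := by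
      rw [← mem_dom_iff, θ.act_mul]
      obtain ⟨w, hw⟩ := Option.isSome_iff_exists.1 (θ.isSome_act s (θ.unit t))
      exact Option.isSome_iff_exists.2 ⟨w, (PEquiv.mem_trans _ _ _ _).2 ⟨_, hv, hw⟩⟩
    have hu : (θ.act (s * t) (θ.unit (s * t)⁻¹)).isSome := by
      rw [mem_dom_iff, θ.unit_idem]
    obtain ⟨w, hw⟩ := Option.isSome_iff_exists.1 hu
    have hw' : w ∈ θ.act (s * t) (θ.unit (s * t)⁻¹) := hw
    rw [θ.act_mul, PEquiv.mem_trans] at hw'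
    obtain ⟨x, hx, hxw⟩ := hw'
    have hxs : θ.unit s⁻¹ * x = x := θ.mem_range (θ.mem_act_inv hxw)
    have hxt : θ.unit t * x = x := θ.mem_range hx
    have h1 := θ.map_mul t _ _ _ _ hv hx
    rw [mul_assoc, hxt, hxs] at h1
    have h2 : v * θ.unit (s * t)⁻¹ = θ.unit (s * t)⁻¹ := (θ.act t).inj h1 hx
    rw [← θ.unit_comm, hvdom] at h2
    subst h2
    exact ⟨θ.app_of_mem hv, θ.mem_range (θ.mem_act_inv hx)⟩
  obtain ⟨key, key2⟩ := key
  refine θ.app_eq ?_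
  rw [θ.act_mul, PEquiv.mem_trans]
  refine ⟨θ.unit s⁻¹ * θ.app t a, ?_, θ.app_mem s _⟩
  have h := θ.app_mem t (θ.unit (s * t)⁻¹ * a)
  rwa [app_mul, key, mul_assoc, unit_mul_app, ← mul_assoc, key2] at h

/-- The `K`-linear map `a ↦ s · a = θ_s(1_{s⁻¹} a)`. -/
def appLin (s : S) : A →ₗ[K] A where
  toFun := θ.app s
  map_add' := θ.app_add s
  map_smul' := θ.app_smul s

@[simp] theorem appLin_apply (s : S) (a : A) : θ.appLin s a = θ.app s a := rfl

/-! ### The algebra `L(A, θ, S)` -/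

/-- The map `g ↦ a δ_s · g`, with `a δ_s · b δ_t = a θ_s(1_{s⁻¹} b) δ_{st}`. -/
noncomputable def convLeft (s : S) (a : A) : (S →₀ A) →ₗ[K] (S →₀ A) :=
  Finsupp.lsum K fun t => Finsupp.lsingle (s * t) ∘ₗ LinearMap.mulLeft K a ∘ₗ θ.appLin s

@[simp] theorem convLeft_single (s t : S) (a b : A) :
    θ.convLeft s a (Finsupp.single t b) = Finsupp.single (s * t) (a * θ.app s b) := by
  rw [convLeft, Finsupp.lsum_single]
  rfl

/-- The bilinear map with `(a δ_s, b δ_t) ↦ a θ_s(1_{s⁻¹} b) δ_{st}`. -/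
noncomputable def conv : (S →₀ A) →ₗ[K] (S →₀ A) →ₗ[K] (S →₀ A) :=
  Finsupp.lsum K fun s =>
    { toFun := fun a => θ.convLeft s a
      map_add' := fun a b => by
        refine Finsupp.lhom_ext fun t c => ?_
        rw [LinearMap.add_apply]
        simp only [convLeft_single, add_mul, Finsupp.single_add]
      map_smul' := fun k a => by
        refine Finsupp.lhom_ext fun t c => ?_
        rw [LinearMap.smul_apply]
        simp only [convLeft_single, smul_mul_assoc, Finsupp.smul_single, RingHom.id_apply] }

@[simp] theorem conv_single_single (s t : S) (a b : A) :
    θ.conv (Finsupp.single s a) (Finsupp.single t b) =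
      Finsupp.single (s * t) (a * θ.app s b) := by
  rw [conv, Finsupp.lsum_single]
  exact θ.convLeft_single s t a b

theorem conv_assoc (f g h : S →₀ A) : θ.conv (θ.conv f g) h = θ.conv f (θ.conv g h) := by
  induction f using Finsupp.induction_linear with
  | zero => simp
  | add f₁ f₂ h₁ h₂ => simp [h₁, h₂]
  | single s a =>
    induction g using Finsupp.induction_linear with
    | zero => simp
    | add f₁ f₂ h₁ h₂ => simp only [_root_.map_add, LinearMap.add_apply, h₁, h₂]
    | single t b =>
      induction h using Finsupp.induction_linear with
      | zero => simp
      | add f₁ f₂ h₁ h₂ => simp only [_root_.map_add, h₁, h₂]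
      | single u c => simp only [conv_single_single, mul_assoc, app_app, app_mul]

/-- The direct sum `⨁_{s ∈ S} (1_s A) δ_s` inside `⨁_{s ∈ S} A δ_s`. -/
def sub : Submodule K (S →₀ A) where
  carrier := {f | ∀ s, θ.unit s * f s = f s}
  add_mem' hf hg s := by simp [mul_add, hf s, hg s]
  zero_mem' s := by simp
  smul_mem' k f hf s := by simp [hf s]

theorem mem_sub {f : S →₀ A} : f ∈ θ.sub ↔ ∀ s, θ.unit s * f s = f s := Iff.rfl

theorem single_mem_sub {s : S} {a : A} (h : θ.unit s * a = a) : Finsupp.single s a ∈ θ.sub := by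
  classical
  intro t
  by_cases hst : s = t
  · subst hst; simpa using h
  · simp [hst]

theorem unit_mul_conv {s t : S} {a b : A} (hb : θ.unit t * b = b) :
    θ.unit (s * t) * (a * θ.app s b) = a * θ.app s b := by
  have h : θ.unit (s * t) * θ.app s b = θ.app s b := by
    rw [← app_apply_one, app_app, ← app_mul, app_apply_one, hb]
  rw [← mul_assoc, θ.unit_comm, mul_assoc, h]

theorem conv_mem {f g : S →₀ A} (hg : g ∈ θ.sub) : θ.conv f g ∈ θ.sub := by
  induction f using Finsupp.induction_linear with
  | zero => simp
  | add f₁ f₂ h₁ h₂ => simpa using add_mem h₁ h₂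
  | single s a =>
    rw [← Finsupp.sum_single g, Finsupp.sum, map_sum]
    refine Submodule.sum_mem _ fun t _ => ?_
    rw [conv_single_single]
    exact θ.single_mem_sub (θ.unit_mul_conv (hg t))

theorem one_conv (f : S →₀ A) : θ.conv (Finsupp.single 1 1) f = f := by
  induction f using Finsupp.induction_linear with
  | zero => simp
  | add f₁ f₂ h₁ h₂ => simp [h₁, h₂]
  | single s a => simp [app_one]

theorem conv_one {f : S →₀ A} (hf : f ∈ θ.sub) : θ.conv f (Finsupp.single 1 1) = f := by
  conv_lhs => rw [← Finsupp.sum_single f, Finsupp.sum, map_sum, LinearMap.sum_apply]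
  conv_rhs => rw [← Finsupp.sum_single f, Finsupp.sum]
  refine Finset.sum_congr rfl fun s _ => ?_
  rw [conv_single_single, app_apply_one, mul_one, ← θ.unit_comm, hf s]

/-- The algebra `L(A, θ, S) = ⨁_{s ∈ S} (1_s A) δ_s` with the product
`a δ_s · b δ_t = a θ_s(1_{s⁻¹} b) δ_{st}`. -/
def L : Type _ := ↥θ.sub

noncomputable instance : AddCommGroup θ.L := inferInstanceAs (AddCommGroup ↥θ.sub)

noncomputable instance : Module K θ.L := inferInstanceAs (Module K ↥θ.sub)

/-- The inclusion of `L(A, θ, S)` into the finitely supported functions `S → A`. -/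
noncomputable def L.incl : θ.L →ₗ[K] (S →₀ A) := θ.sub.subtype

theorem L.incl_injective : Function.Injective (L.incl θ) := Subtype.val_injective

theorem L.incl_mem (x : θ.L) : L.incl θ x ∈ θ.sub := x.2

/-- The element of `L(A, θ, S)` with a given family of coefficients. -/
noncomputable def L.ofMem (f : S →₀ A) (hf : f ∈ θ.sub) : θ.L := ⟨f, hf⟩

@[simp] theorem L.incl_ofMem (f : S →₀ A) (hf : f ∈ θ.sub) : L.incl θ (L.ofMem θ f hf) = f := rfl

noncomputable instance : Mul θ.L :=
  ⟨fun x y => L.ofMem θ (θ.conv (L.incl θ x) (L.incl θ y)) (θ.conv_mem (L.incl_mem θ y))⟩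

noncomputable instance : One θ.L :=
  ⟨L.ofMem θ (Finsupp.single 1 1) (θ.single_mem_sub (by rw [unit_one, one_mul]))⟩

@[simp] theorem L.incl_mul (x y : θ.L) :
    L.incl θ (x * y) = θ.conv (L.incl θ x) (L.incl θ y) := rfl

@[simp] theorem L.incl_one : L.incl θ (1 : θ.L) = Finsupp.single 1 1 := rfl

noncomputable instance : Ring θ.L :=
  { (inferInstance : AddCommGroup θ.L), (inferInstance : Mul θ.L), (inferInstance : One θ.L) with
    left_distrib := fun x y z => L.incl_injective θ (by simp)
    right_distrib := fun x y z => L.incl_injective θ (by simp)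
    zero_mul := fun x => L.incl_injective θ (by simp)
    mul_zero := fun x => L.incl_injective θ (by simp)
    mul_assoc := fun x y z => L.incl_injective θ (by simp [conv_assoc])
    one_mul := fun x => L.incl_injective θ (by simp [one_conv])
    mul_one := fun x => L.incl_injective θ (by simp [θ.conv_one (L.incl_mem θ x)]) }

noncomputable instance : Algebra K θ.L :=
  Algebra.ofModule (fun k x y => L.incl_injective θ (by simp))
    (fun k x y => L.incl_injective θ (by simp))

/-- The element `a δ_s` of `L(A, θ, S)`, for `a ∈ 1_s A`. -/
noncomputable def δ (s : S) (a : A) (h : θ.unit s * a = a) : θ.L :=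
  L.ofMem θ (Finsupp.single s a) (θ.single_mem_sub h)

/-! ### The crossed product -/

/-- The ideal `𝓝` of `L(A, θ, S)` generated by the elements `a δ_s - a δ_t` with `a ∈ 1_s A` and
`s ≤ t`. -/
noncomputable def idealN : TwoSidedIdeal θ.L :=
  TwoSidedIdeal.span {x | ∃ (s t : S) (a : A), NatLE s t ∧ θ.unit s * a = a ∧
    L.incl θ x = Finsupp.single s a - Finsupp.single t a}

/-- The crossed product `A ⋊_θ S = L(A, θ, S) / 𝓝`. -/
def CrossedProduct : Type _ := θ.idealN.ringCon.Quotient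

noncomputable instance : Ring θ.CrossedProduct := inferInstanceAs (Ring θ.idealN.ringCon.Quotient)

noncomputable instance : Algebra K θ.CrossedProduct :=
  inferInstanceAs (Algebra K θ.idealN.ringCon.Quotient)

/-- The quotient map `L(A, θ, S) → A ⋊_θ S`. -/
noncomputable def toCrossed : θ.L →ₐ[K] θ.CrossedProduct :=
  { θ.idealN.ringCon.mk' with commutes' := fun _ => rfl }

/-- The element `1_s δ_s` of `A ⋊_θ S`. -/
noncomputable def gamma (s : S) : θ.CrossedProduct := θ.toCrossed (θ.δ s (θ.unit s) (θ.unit_idem s))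

/-- The element `a δ_1` of `A ⋊_θ S`. -/
noncomputable def ofA (a : A) : θ.CrossedProduct :=
  θ.toCrossed (θ.δ 1 a (by rw [unit_one, one_mul]))

theorem toCrossed_δ_mul {s t r : S} {a b c : A} (ha : θ.unit s * a = a) (hb : θ.unit t * b = b)
    (hc : θ.unit r * c = c) (hr : s * t = r) (h : a * θ.app s b = c) :
    θ.toCrossed (θ.δ s a ha) * θ.toCrossed (θ.δ t b hb) = θ.toCrossed (θ.δ r c hc) := by
  subst hr h
  rw [← _root_.map_mul]
  congr 1
  exact L.incl_injective θ (by simp [δ])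

theorem gamma_one : θ.gamma 1 = 1 := by
  rw [← _root_.map_one θ.toCrossed]
  exact congrArg θ.toCrossed (L.incl_injective θ (by simp [δ, unit_one]))

theorem gamma_mul (s t : S) : θ.gamma (s * t) = θ.gamma s * θ.gamma t := by
  refine (θ.toCrossed_δ_mul _ _ _ rfl ?_).symm
  rw [← app_apply_one, ← app_apply_one, ← app_apply_one, app_app, ← app_mul, one_mul]

theorem ofA_mul_gamma (s : S) (a : A) :
    θ.ofA a * θ.gamma s = θ.gamma s * θ.ofA (θ.app s⁻¹ a) := by
  have h : θ.unit s * (θ.unit s * a) = θ.unit s * a := by rw [← mul_assoc, θ.unit_idem]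
  refine (θ.toCrossed_δ_mul _ _ h (one_mul s) ?_).trans (θ.toCrossed_δ_mul _ _ h (mul_one s) ?_).symm
  · rw [app_one, θ.unit_comm]
  · rw [app_inv_app, h]

theorem gamma_inv_mul_ofA (s : S) (a : A) :
    θ.gamma s⁻¹ * θ.ofA a = θ.ofA (θ.app s⁻¹ a) * θ.gamma s⁻¹ := by
  refine (θ.toCrossed_δ_mul _ _ (θ.unit_mul_app s⁻¹ a) (mul_one _) ?_).trans
    (θ.toCrossed_δ_mul _ _ _ (one_mul _) ?_).symm
  · rw [unit_mul_app]
  · rw [app_one, ← θ.unit_comm, unit_mul_app]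

end Basic

/-! ### Modules over the semigroup algebra from bimodules over the crossed product -/

section Bimodule

variable {K S A : Type*} [CommRing K] [InverseMonoid S] [Ring A] [Algebra K A]
  (θ : UnitalAction K S A)
  (M : Type*) [AddCommGroup M] [Module K M] [Module θ.CrossedProduct M]
  [Module θ.CrossedProductᵐᵒᵖ M] [IsScalarTower K θ.CrossedProduct M]
  [IsScalarTower K θ.CrossedProductᵐᵒᵖ M] [SMulCommClass θ.CrossedProduct θ.CrossedProductᵐᵒᵖ M]

/-- The left `K S`-module structure of an `A ⋊_θ S`-bimodule:
`s · x = (1_s δ_s) x (1_{s⁻¹} δ_{s⁻¹})`. -/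
noncomputable def bimoduleRep : Representation K S M where
  toFun s :=
    { toFun := fun x => θ.gamma s • (MulOpposite.op (θ.gamma s⁻¹) • x)
      map_add' := fun x y => by simp only [smul_add]
      map_smul' := fun k x => by
        rw [RingHom.id_apply, smul_comm (MulOpposite.op (θ.gamma s⁻¹)) k x,
          smul_comm (θ.gamma s) k] }
  map_one' := by
    ext x
    simp [inv_one', gamma_one]
  map_mul' s t := by
    ext x
    simp only [LinearMap.coe_mk, AddHom.coe_mk, Module.End.mul_apply, mul_inv_rev', gamma_mul,
      MulOpposite.op_mul, mul_smul]
    rw [smul_comm (θ.gamma t) (MulOpposite.op (θ.gamma s⁻¹))]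

theorem bimoduleRep_apply (s : S) (x : M) :
    θ.bimoduleRep M s x = θ.gamma s • (MulOpposite.op (θ.gamma s⁻¹) • x) := rfl

/-- The `K`-submodule `M^A = {x | a x = x a for all a ∈ A}` of invariants, where `A` acts on both
sides through `a ↦ a δ_1`. -/
def invariants : Submodule K M where
  carrier := {x | ∀ a : A, θ.ofA a • x = MulOpposite.op (θ.ofA a) • x}
  add_mem' hx hy a := by rw [smul_add, smul_add, hx a, hy a]
  zero_mem' a := by simp
  smul_mem' k x hx a := by
    rw [smul_comm (θ.ofA a) k x, smul_comm (MulOpposite.op (θ.ofA a)) k x, hx a]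

theorem bimoduleRep_mem (s : S) {x : M} (hx : x ∈ θ.invariants M) :
    θ.bimoduleRep M s x ∈ θ.invariants M := by
  intro a
  rw [bimoduleRep_apply, smul_smul, ofA_mul_gamma, mul_smul,
    smul_comm (θ.ofA (θ.app s⁻¹ a)) (MulOpposite.op (θ.gamma s⁻¹)) x, hx (θ.app s⁻¹ a),
    smul_smul (MulOpposite.op _), ← MulOpposite.op_mul, ← gamma_inv_mul_ofA, MulOpposite.op_mul,
    mul_smul, smul_comm (θ.gamma s) (MulOpposite.op (θ.ofA a))]

/-- The left `K S`-submodule structure of `M^A`. -/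
noncomputable def invariantsRep : Representation K S (θ.invariants M) where
  toFun s := (θ.bimoduleRep M s).restrict fun _ hx => θ.bimoduleRep_mem M s hx
  map_one' := by
    ext x
    simp
  map_mul' s t := by
    ext x
    simp

/-- `M^A` as a left module over the semigroup algebra `K S`. -/
noncomputable instance invariantsModule : Module (MonoidAlgebra K S) (θ.invariants M) :=
  Module.compHom _ (θ.invariantsRep M).asAlgebraHom.toRingHom

end Bimodule

end UnitalAction

/-!
Write `R = A ⋊_θ S`. The elements `1_e δ_e` for `e ∈ E(S)` span a commutative subalgebra of `R`
that commutes with `A`, and for a `K S`-module `V` the left `R`-module `R ⊗_{K E(S)} V` is an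
`R`-bimodule, where `a δ_s` acts from the right by `x ⊗ v ↦ x a δ_s ⊗ s⁻¹ v`. This induction
functor is left adjoint to `M ↦ M^A`. It is exact, because `K E(S)` is spanned by idempotents, so
that its localizations at prime ideals are fields and all its modules are flat. If `A` is separable,
then `M ↦ M^A` is exact, so induction preserves projective modules. Finally, induction takes
`K E(S)` to `R`. Hence it turns a projective resolution of `K E(S)` over `K S` into a projective
bimodule resolution of `R`, and the adjunction identifies the two complexes of homomorphisms.
-/

/-! ### Modules over algebras spanned by idempotents -/

section Flat

variable {B C : Type*} [CommRing B] [CommRing C] [IsLocalRing C]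

theorem eq_zero_or_one_of_isIdempotentElem_of_isLocalRing {e : C} (he : IsIdempotentElem e) :
    e = 0 ∨ e = 1 := by
  rcases IsLocalRing.isUnit_or_isUnit_one_sub_self e with h | h
  · exact Or.inr ((IsIdempotentElem.iff_eq_one_of_isUnit h).1 he)
  · refine Or.inl (h.mul_left_cancel ?_)
    rw [sub_mul, one_mul, he.eq, sub_self, mul_zero]

theorem algHom_mem_bot_of_span_idempotents {K : Type*} [CommRing K] [Algebra K B] [Algebra K C]
    (h : Submodule.span K {e : B | IsIdempotentElem e} = ⊤) (f : B →ₐ[K] C) (b : B) :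
    f b ∈ (⊥ : Subalgebra K C) := by
  have hle : Submodule.span K {e : B | IsIdempotentElem e} ≤
      (Subalgebra.toSubmodule (⊥ : Subalgebra K C)).comap f.toLinearMap := by
    refine Submodule.span_le.2 fun e he => ?_
    change f e ∈ (⊥ : Subalgebra K C)
    rcases eq_zero_or_one_of_isIdempotentElem_of_isLocalRing (he.map f) with h0 | h1
    · exact h0 ▸ zero_mem _
    · exact h1 ▸ one_mem _
  exact hle (h ▸ Submodule.mem_top)

variable {K : Type*} [Field K] [Algebra K B]

theorem isField_localization_of_span_idempotents
    (h : Submodule.span K {e : B | IsIdempotentElem e} = ⊤) (P : Ideal B) [P.IsPrime] :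
    IsField (Localization.AtPrime P) := by
  have hbot :=
    algHom_mem_bot_of_span_idempotents h (IsScalarTower.toAlgHom K B (Localization.AtPrime P))
  have hsurj : Function.Surjective (algebraMap K (Localization.AtPrime P)) := fun x => by
    obtain ⟨⟨b, s⟩, hbs⟩ := IsLocalization.surj P.primeCompl x
    obtain ⟨k, hk⟩ := Algebra.mem_bot.1 (hbot b)
    obtain ⟨l, hl⟩ := Algebra.mem_bot.1 (hbot s)
    have hunit := IsLocalization.map_units (Localization.AtPrime P) s
    rw [IsScalarTower.coe_toAlgHom'] at hk hl
    rw [← hl] at hunit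
    have hl0 : l ≠ 0 := by
      rintro rfl
      exact not_isUnit_zero ((map_zero (algebraMap K (Localization.AtPrime P))) ▸ hunit)
    refine ⟨k * l⁻¹, hunit.mul_left_injective ?_⟩
    change algebraMap K _ (k * l⁻¹) * algebraMap K _ l = x * algebraMap K _ l
    rw [← map_mul, inv_mul_cancel_right₀ hl0, hk, hl, hbs]
  exact (RingEquiv.ofBijective _
    ⟨(algebraMap K (Localization.AtPrime P)).injective, hsurj⟩).symm.toMulEquiv.isField
      (Field.toIsField K)

theorem flat_of_span_idempotents (h : Submodule.span K {e : B | IsIdempotentElem e} = ⊤)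
    (M : Type*) [AddCommGroup M] [Module B M] : Module.Flat B M := by
  refine Module.flat_of_localized_maximal M fun P _ => ?_
  let _ := (isField_localization_of_span_idempotents h P).toField
  exact Module.Flat.trans B (Localization.AtPrime P) _

end Flat

/-! ### Bimodules as modules over a tensor product of algebras -/

section Bimodule

variable {K A B : Type*} [CommRing K] [Ring A] [Algebra K A] [Ring B] [Algebra K B]

theorem exists_bimodule_of_module_tensorProduct {N : Type*} [AddCommGroup N]
    (inst : Module (A ⊗[K] B) N) :
    ∃ (_ : Module K N) (_ : Module A N) (_ : Module B N) (_ : IsScalarTower K A N)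
      (_ : IsScalarTower K B N) (_ : SMulCommClass A B N),
      inst = TensorProduct.Algebra.module := by
  let left : A →ₐ[K] A ⊗[K] B := Algebra.TensorProduct.includeLeft
  let right : B →ₐ[K] A ⊗[K] B := Algebra.TensorProduct.includeRight
  have left_mul_right (a b) : left a * right b = a ⊗ₜ b := by simp [left, right]
  have right_mul_left (a b) : right b * left a = a ⊗ₜ b := by simp [left, right]
  let _ : Module K N := Module.compHom N (algebraMap K (A ⊗[K] B))
  let _ : Module A N := Module.compHom N left.toRingHom
  let _ : Module B N := Module.compHom N right.toRingHom
  have towerA : IsScalarTower K A N := ⟨fun k a x => by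
    change left (k • a) • x = algebraMap K (A ⊗[K] B) k • left a • x
    rw [map_smul, Algebra.smul_def, mul_smul]⟩
  have towerB : IsScalarTower K B N := ⟨fun k b x => by
    change right (k • b) • x = algebraMap K (A ⊗[K] B) k • right b • x
    rw [map_smul, Algebra.smul_def, mul_smul]⟩
  have comm : SMulCommClass A B N := ⟨fun a b x => by
    change left a • right b • x = right b • left a • x
    rw [smul_smul, smul_smul, left_mul_right, right_mul_left]⟩
  refine ⟨_, _, _, towerA, towerB, comm, Module.ext' _ _ fun c x => ?_⟩
  induction c using TensorProduct.induction_on with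
  | zero => exact (inst.zero_smul x).trans (TensorProduct.Algebra.module.zero_smul x).symm
  | add c d hc hd =>
    exact (inst.add_smul c d x).trans
      ((congrArg₂ (· + ·) hc hd).trans (TensorProduct.Algebra.module.add_smul c d x).symm)
  | tmul a b =>
    refine Eq.trans ?_ (TensorProduct.Algebra.smul_def a b x).symm
    change (a ⊗ₜ[K] b) • x = left a • right b • x
    rw [smul_smul, left_mul_right]

attribute [local instance] TensorProduct.Algebra.module

variable {N P : Type*} [AddCommGroup N] [Module K N] [Module A N] [Module B N]
  [IsScalarTower K A N] [IsScalarTower K B N] [SMulCommClass A B N] [AddCommGroup P]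
  [Module K P] [Module A P] [Module B P] [IsScalarTower K A P] [IsScalarTower K B P]
  [SMulCommClass A B P]

/-- A homomorphism of bimodules, viewed as a homomorphism of modules over `A ⊗ B`. -/
def bimoduleHom (f : N →ₗ[A] P) (hf : ∀ (b : B) x, f (b • x) = b • f x) : N →ₗ[A ⊗[K] B] P where
  __ := f.toAddHom
  map_smul' c x := by
    induction c using TensorProduct.induction_on with
    | zero => simp only [zero_smul, AddHom.toFun_eq_coe, LinearMap.coe_toAddHom, map_zero]
    | add c d hc hd =>
      simp only [AddHom.toFun_eq_coe, LinearMap.coe_toAddHom, RingHom.id_apply] at hc hd ⊢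
      rw [add_smul, map_add, hc, hd, add_smul]
    | tmul a b => simp [TensorProduct.Algebra.smul_def, hf]

theorem tmul_one_smul (a : A) (x : N) : (a ⊗ₜ[K] (1 : B)) • x = a • x := by
  rw [TensorProduct.Algebra.smul_def, one_smul]

theorem one_tmul_smul (b : B) (x : N) : ((1 : A) ⊗ₜ[K] b) • x = b • x := by
  rw [TensorProduct.Algebra.smul_def, one_smul]

theorem map_left_smul (f : N →ₗ[A ⊗[K] B] P) (a : A) (x : N) : f (a • x) = a • f x := by
  rw [← tmul_one_smul (K := K) (B := B) a x, map_smul, tmul_one_smul]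

theorem map_right_smul (f : N →ₗ[A ⊗[K] B] P) (b : B) (x : N) : f (b • x) = b • f x := by
  rw [← one_tmul_smul (K := K) (A := A) b x, map_smul, one_tmul_smul]

end Bimodule

/-! ### Lifting central elements over a separable algebra -/

section Separable

variable {K A : Type*} [CommRing K] [Ring A] [Algebra K A]

open MulOpposite

attribute [local instance] TensorProduct.Algebra.module

theorem smul_eq_of_forall_central {N : Type*} [AddCommGroup N] [Module (A ⊗[K] Aᵐᵒᵖ) N] {y : N}
    (hy : ∀ a : A, (a ⊗ₜ[K] (1 : Aᵐᵒᵖ)) • y = ((1 : A) ⊗ₜ[K] op a) • y) (c : A ⊗[K] Aᵐᵒᵖ) :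
    c • y = ((c • (1 : A)) ⊗ₜ[K] (1 : Aᵐᵒᵖ)) • y := by
  induction c using TensorProduct.induction_on with
  | zero =>
    have hzero : (0 : A ⊗[K] Aᵐᵒᵖ) • (1 : A) = 0 := zero_smul (A ⊗[K] Aᵐᵒᵖ) (1 : A)
    rw [hzero, TensorProduct.zero_tmul]
  | add c d hc hd => rw [add_smul, add_smul, TensorProduct.add_tmul, add_smul, hc, hd]
  | tmul a b =>
    have hab : a ⊗ₜ[K] b = (a ⊗ₜ[K] 1) * ((1 : A) ⊗ₜ[K] b) := by simp
    rw [hab, mul_smul, ← op_unop b, ← hy, smul_smul]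
    simp [TensorProduct.Algebra.smul_def]

theorem IsSeparableAlgebra.exists_separabilityIdempotent (hA : IsSeparableAlgebra K A) :
    ∃ e : A ⊗[K] Aᵐᵒᵖ,
      (∀ a : A, (a ⊗ₜ[K] 1) * e = (1 ⊗ₜ[K] op a) * e) ∧ e • (1 : A) = 1 := by
  have : Module.Projective (A ⊗[K] Aᵐᵒᵖ) A := hA
  obtain ⟨σ, hσ⟩ := Module.projective_lifting_property
    (LinearMap.toSpanSingleton (A ⊗[K] Aᵐᵒᵖ) A 1) LinearMap.id
    fun a => ⟨a ⊗ₜ[K] 1, by simp [TensorProduct.Algebra.smul_def]⟩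
  refine ⟨σ 1, fun a => ?_, LinearMap.congr_fun hσ 1⟩
  rw [← smul_eq_mul, ← smul_eq_mul, ← map_smul, ← map_smul]
  simp [TensorProduct.Algebra.smul_def]

theorem IsSeparableAlgebra.exists_central_lift (hA : IsSeparableAlgebra K A) {N P : Type*}
    [AddCommGroup N] [Module (A ⊗[K] Aᵐᵒᵖ) N] [AddCommGroup P] [Module (A ⊗[K] Aᵐᵒᵖ) P]
    (p : N →ₗ[A ⊗[K] Aᵐᵒᵖ] P) (hp : Function.Surjective p) {y : P}
    (hy : ∀ a : A, (a ⊗ₜ[K] (1 : Aᵐᵒᵖ)) • y = ((1 : A) ⊗ₜ[K] op a) • y) :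
    ∃ x, (∀ a : A, (a ⊗ₜ[K] (1 : Aᵐᵒᵖ)) • x = ((1 : A) ⊗ₜ[K] op a) • x) ∧ p x = y := by
  obtain ⟨e, he, he1⟩ := hA.exists_separabilityIdempotent
  obtain ⟨x, rfl⟩ := hp y
  refine ⟨e • x, fun a => by rw [smul_smul, he, mul_smul], ?_⟩
  rw [map_smul, smul_eq_of_forall_central hy, he1, ← Algebra.TensorProduct.one_def, one_smul]

end Separable

/-! ### The semilattice of idempotents -/

namespace InverseMonoid

variable {S : Type*} [InverseMonoid S]

noncomputable instance : CommMonoid (Idem S) where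
  mul e f := ⟨e.1 * f.1, idem_mul e.2 f.2⟩
  one := ⟨1, one_mul 1⟩
  mul_assoc _ _ _ := Subtype.ext (mul_assoc _ _ _)
  one_mul _ := Subtype.ext (one_mul _)
  mul_one _ := Subtype.ext (mul_one _)
  mul_comm e f := Subtype.ext (idem_comm e.2 f.2)

variable (S) in
/-- The inclusion of `E(S)` into `S` as a monoid homomorphism. -/
def idemIncl : Idem S →* S where
  toFun := Subtype.val
  map_one' := rfl
  map_mul' _ _ := rfl

@[simp] theorem idemIncl_apply (e : Idem S) : idemIncl S e = e.1 := rfl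

theorem mul_conjIdem_inv (s : S) (e : Idem S) : s * (conjIdem s⁻¹ e).1 = e.1 * s := by
  calc s * (s⁻¹ * e.1 * s⁻¹⁻¹) = s * s⁻¹ * e.1 * s := by simp only [inv_inv', mul_assoc]
    _ = e.1 * (s * s⁻¹ * s) := by rw [idem_comm (idem_mul_inv s) e.2, mul_assoc]
    _ = e.1 * s := by rw [mul_inv_mul]

theorem conjIdem_inv_mul_inv (s : S) (e : Idem S) : (conjIdem s⁻¹ e).1 * s⁻¹ = s⁻¹ * e.1 := by
  calc s⁻¹ * e.1 * s⁻¹⁻¹ * s⁻¹ = s⁻¹ * (e.1 * (s * s⁻¹)) := by simp only [inv_inv', mul_assoc]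
    _ = s⁻¹ * s * s⁻¹ * e.1 := by rw [idem_comm e.2 (idem_mul_inv s), ← mul_assoc, ← mul_assoc]
    _ = s⁻¹ * e.1 := by rw [inv_mul_inv]

theorem single_eq_smul_of {K G : Type*} [CommSemiring K] [Monoid G] (k : K) (g : G) :
    MonoidAlgebra.single g k = k • MonoidAlgebra.of K G g := by
  rw [MonoidAlgebra.of_apply, MonoidAlgebra.smul_single, smul_eq_mul, mul_one]

theorem span_isIdempotentElem_idemAlgebra (K : Type*) [CommRing K] :
    Submodule.span K {x : MonoidAlgebra K (Idem S) | IsIdempotentElem x} = ⊤ := by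
  refine eq_top_iff.2 fun x _ => ?_
  induction x using MonoidAlgebra.induction_linear with
  | zero => exact zero_mem _
  | add x y hx hy => exact add_mem (hx trivial) (hy trivial)
  | single e k =>
    have he : IsIdempotentElem e := Subtype.ext e.2
    rw [single_eq_smul_of]
    exact Submodule.smul_mem _ _ (Submodule.subset_span (he.map (MonoidAlgebra.of K (Idem S))))

end InverseMonoid

namespace UnitalAction

open InverseMonoid

/-! ### The universal property of the crossed product -/

section Crossed

variable {K S A : Type*} [CommRing K] [InverseMonoid S] [Ring A] [Algebra K A]
  (θ : UnitalAction K S A)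

theorem toCrossed_eq_of_natLE {s t : S} {a : A} (hst : NatLE s t) (hs : θ.unit s * a = a)
    (ht : θ.unit t * a = a) : θ.toCrossed (θ.δ s a hs) = θ.toCrossed (θ.δ t a ht) := by
  refine (RingCon.eq θ.idealN.ringCon).2 ((θ.idealN.rel_iff _ _).2 ?_)
  exact TwoSidedIdeal.subset_span ⟨s, t, a, hst, hs, by simp [δ]⟩

theorem gamma_idem (e : Idem S) : θ.gamma e.1 = θ.ofA (θ.unit e.1) :=
  θ.toCrossed_eq_of_natLE ⟨e.1, e.2, (mul_one _).symm⟩ _ _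

/-- The homomorphism `a ↦ a δ_1` from `A` to `A ⋊_θ S`. -/
noncomputable def ofAHom : A →ₐ[K] θ.CrossedProduct :=
  AlgHom.ofLinearMap
    (θ.toCrossed.toLinearMap ∘ₗ
      { toFun := fun a => θ.δ 1 a (by rw [unit_one, one_mul])
        map_add' := fun a b => L.incl_injective θ (by simp [δ])
        map_smul' := fun k a => L.incl_injective θ (by simp [δ]) })
    (_root_.map_one θ.toCrossed)
    (fun a b => by
      have h : ∀ c : A, θ.unit 1 * c = c := fun c => by rw [unit_one, one_mul]
      exact (θ.toCrossed_δ_mul (h a) (h b) (h _) (one_mul 1) (by rw [app_one])).symm)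

@[simp] theorem ofAHom_apply (a : A) : θ.ofAHom a = θ.ofA a := rfl

theorem ofA_mul (a b : A) : θ.ofA (a * b) = θ.ofA a * θ.ofA b := _root_.map_mul θ.ofAHom a b

/-- The homomorphism `s ↦ 1_s δ_s` from `S` to the multiplicative monoid of `A ⋊_θ S`. -/
noncomputable def gammaHom : S →* θ.CrossedProduct where
  toFun := θ.gamma
  map_one' := θ.gamma_one
  map_mul' := θ.gamma_mul

theorem toCrossed_δ (s : S) (a : A) (h : θ.unit s * a = a) :
    θ.toCrossed (θ.δ s a h) = θ.ofA a * θ.gamma s := by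
  refine (θ.toCrossed_δ_mul _ _ h (one_mul s) ?_).symm
  rw [app_one, ← θ.unit_comm, h]

theorem gamma_mul_ofA (s : S) (a : A) :
    θ.gamma s * θ.ofA a = θ.ofA (θ.app s a) * θ.gamma s := by
  simpa only [inv_inv'] using θ.gamma_inv_mul_ofA s⁻¹ a

theorem gamma_idem_mul_ofA (e : Idem S) (a : A) :
    θ.gamma e.1 * θ.ofA a = θ.ofA a * θ.gamma e.1 := by
  rw [gamma_idem, ← ofA_mul, ← ofA_mul, θ.unit_comm]

theorem unit_mul_inv (s : S) : θ.unit (s * s⁻¹) = θ.unit s := by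
  rw [← app_apply_one, app_app, app_inv_app, mul_one]

theorem unit_mul_unit_mul (s t : S) : θ.unit s * θ.unit (s * t) = θ.unit (s * t) := by
  rw [← θ.app_apply_one (s * t), app_app, unit_mul_app]

theorem CrossedProduct.induction {p : θ.CrossedProduct → Prop} (ofA : ∀ a, p (θ.ofA a))
    (gamma : ∀ s, p (θ.gamma s)) (add : ∀ x y, p x → p y → p (x + y))
    (mul : ∀ x y, p x → p y → p (x * y)) (x : θ.CrossedProduct) : p x := by
  obtain ⟨x, rfl⟩ : ∃ y, θ.toCrossed y = x := RingCon.mk'_surjective _ x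
  have hx : x = ∑ s ∈ (L.incl θ x).support, θ.δ s (L.incl θ x s) (L.incl_mem θ x s) := by
    refine L.incl_injective θ ?_
    conv_lhs => rw [← Finsupp.sum_single (L.incl θ x), Finsupp.sum]
    rw [map_sum]
    rfl
  rw [hx, map_sum]
  refine Finset.sum_induction _ p add (_root_.map_zero θ.ofAHom ▸ ofA 0) fun s _ => ?_
  rw [toCrossed_δ]
  exact mul _ _ (ofA _) (gamma s)

section Lift

variable {D : Type*} [Ring D] [Algebra K D] (f : A →ₐ[K] D) (g : S →* D)

/-- The linear map `a δ_s ↦ f a * g s`. -/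
noncomputable def finsuppLift : (S →₀ A) →ₗ[K] D :=
  Finsupp.lsum K fun s => LinearMap.mulRight K (g s) ∘ₗ f.toLinearMap

@[simp] theorem finsuppLift_single (s : S) (a : A) :
    finsuppLift f g (Finsupp.single s a) = f a * g s := by
  simp [finsuppLift]

variable {f g}

theorem finsuppLift_conv (hfg : ∀ s a, g s * f a = f (θ.app s a) * g s) (x y : S →₀ A) :
    finsuppLift f g (θ.conv x y) = finsuppLift f g x * finsuppLift f g y := by
  induction x using Finsupp.induction_linear with
  | zero => simp
  | add x₁ x₂ h₁ h₂ => simp only [_root_.map_add, LinearMap.add_apply, h₁, h₂, add_mul]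
  | single s a =>
    induction y using Finsupp.induction_linear with
    | zero => simp
    | add y₁ y₂ h₁ h₂ => simp only [_root_.map_add, h₁, h₂, mul_add]
    | single t b =>
      rw [conv_single_single, finsuppLift_single, finsuppLift_single, finsuppLift_single,
        _root_.map_mul, _root_.map_mul]
      calc f a * f (θ.app s b) * (g s * g t) = f a * (f (θ.app s b) * g s) * g t := by
            simp only [mul_assoc]
        _ = f a * g s * (f b * g t) := by rw [← hfg]; simp only [mul_assoc]

/-- The universal property of `A ⋊_θ S`: a homomorphism `f` on `A` and a multiplicative map `g` on
`S` such that `g` implements the action on the image of `f` and `f 1_e = g e` for idempotent `e`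
define a homomorphism `a δ_s ↦ f a * g s`. -/
noncomputable def CrossedProduct.lift (hfg : ∀ s a, g s * f a = f (θ.app s a) * g s)
    (hunit : ∀ e : Idem S, f (θ.unit e.1) = g e.1) : θ.CrossedProduct →ₐ[K] D :=
  let φ : θ.L →ₐ[K] D := AlgHom.ofLinearMap (finsuppLift f g ∘ₗ L.incl θ) (by simp)
    fun x y => θ.finsuppLift_conv hfg (L.incl θ x) (L.incl θ y)
  θ.idealN.ringCon.liftₐ φ fun x y hxy => by
    have hle : θ.idealN ≤ TwoSidedIdeal.ker φ := by
      refine TwoSidedIdeal.span_le.2 ?_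
      rintro x ⟨s, t, a, ⟨e, he, rfl⟩, ha, hx⟩
      refine (TwoSidedIdeal.mem_ker φ).2 ?_
      have hae : f a * g e = f a := by
        rw [← hunit ⟨e, he⟩, ← _root_.map_mul, ← θ.unit_comm, ← ha, ← mul_assoc, unit_mul_unit_mul]
      change finsuppLift f g (L.incl θ x) = 0
      rw [hx, map_sub, finsuppLift_single, finsuppLift_single, _root_.map_mul, ← mul_assoc, hae,
        sub_self]
    have hmem := hle ((θ.idealN.rel_iff x y).1 hxy)
    rw [TwoSidedIdeal.mem_ker, map_sub, sub_eq_zero] at hmem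
    exact hmem

variable (hfg : ∀ s a, g s * f a = f (θ.app s a) * g s)
  (hunit : ∀ e : Idem S, f (θ.unit e.1) = g e.1)

@[simp] theorem CrossedProduct.lift_ofA (a : A) :
    CrossedProduct.lift θ hfg hunit (θ.ofA a) = f a := by
  refine (finsuppLift_single f g 1 a).trans ?_
  rw [_root_.map_one, mul_one]

@[simp] theorem CrossedProduct.lift_gamma (s : S) :
    CrossedProduct.lift θ hfg hunit (θ.gamma s) = g s := by
  refine (finsuppLift_single f g s (θ.unit s)).trans ?_
  rw [← θ.unit_mul_inv, hunit ⟨s * s⁻¹, idem_mul_inv s⟩, ← _root_.map_mul, mul_inv_mul]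

end Lift

end Crossed

end UnitalAction

namespace UnitalAction

open InverseMonoid MulOpposite

/-! ### Modules induced from the semilattice of idempotents -/

section IdemModule

variable {K S : Type*} [CommRing K] [InverseMonoid S]

/-- A `K S`-module regarded as a module over the subalgebra `K E(S)`. -/
@[reducible] noncomputable def idemModuleOfModule (V : Type*) [AddCommGroup V]
    [Module (MonoidAlgebra K S) V] : Module (MonoidAlgebra K (Idem S)) V :=
  Module.compHom V (MonoidAlgebra.mapDomainRingHom K (idemIncl S))

attribute [local instance] idemModuleOfModule

theorem single_idem_smul {V : Type*} [AddCommGroup V] [Module (MonoidAlgebra K S) V] (e : Idem S)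
    (k : K) (v : V) : MonoidAlgebra.single e k • v = MonoidAlgebra.single e.1 k • v := by
  change MonoidAlgebra.mapDomainRingHom K (idemIncl S) (MonoidAlgebra.single e k) • v = _
  rw [MonoidAlgebra.mapDomainRingHom_apply, MonoidAlgebra.mapDomain_single, idemIncl_apply]

theorem map_smul_of_map_single_smul {V W : Type*} [AddCommGroup V] [AddCommGroup W]
    [Module (MonoidAlgebra K S) V] [Module (MonoidAlgebra K S) W] (f : V →+ W)
    (hf : ∀ (s : S) (k : K) v, f (MonoidAlgebra.single s k • v) = MonoidAlgebra.single s k • f v)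
    (b : MonoidAlgebra K S) (v : V) : f (b • v) = b • f v := by
  induction b using MonoidAlgebra.induction_linear with
  | zero => rw [zero_smul, zero_smul, _root_.map_zero]
  | add b c hb hc => rw [add_smul, add_smul, _root_.map_add, hb, hc]
  | single s k => exact hf s k v

end IdemModule

section Induced

variable {K S A : Type*} [CommRing K] [InverseMonoid S] [Ring A] [Algebra K A]
  (θ : UnitalAction K S A)

/-- The homomorphism `e ↦ 1_e δ_e` from `K E(S)` to `A ⋊_θ S`. -/
noncomputable def idemHom : MonoidAlgebra K (Idem S) →ₐ[K] θ.CrossedProduct :=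
  MonoidAlgebra.lift K _ _ (θ.gammaHom.comp (idemIncl S))

@[simp] theorem idemHom_single (e : Idem S) (k : K) :
    θ.idemHom (MonoidAlgebra.single e k) = k • θ.gamma e.1 :=
  MonoidAlgebra.lift_single _ _ _

/-- `A ⋊_θ S` as a module over the commutative algebra `K E(S)`, by right multiplication. -/
noncomputable instance crossedIdemModule : Module (MonoidAlgebra K (Idem S)) θ.CrossedProduct :=
  Module.compHom _ (θ.idemHom.toOpposite fun x y => Commute.map (mul_comm x y) _).toRingHom

theorem idem_smul_eq_mul (b : MonoidAlgebra K (Idem S)) (x : θ.CrossedProduct) :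
    b • x = x * θ.idemHom b := rfl

instance : SMulCommClass (MonoidAlgebra K (Idem S)) θ.CrossedProduct θ.CrossedProduct :=
  ⟨fun b x y => mul_assoc x y (θ.idemHom b)⟩

instance : SMulCommClass (MonoidAlgebra K (Idem S)) K θ.CrossedProduct :=
  ⟨fun b k x => smul_mul_assoc k x (θ.idemHom b)⟩

attribute [local instance] idemModuleOfModule

/-- The left `A ⋊_θ S`-module induced from the `K E(S)`-module underlying a `K S`-module `V`. -/
abbrev Induced (V : Type*) [AddCommGroup V] [Module (MonoidAlgebra K S) V] : Type _ :=
  θ.CrossedProduct ⊗[MonoidAlgebra K (Idem S)] V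

namespace Induced

variable {V : Type*} [AddCommGroup V] [Module (MonoidAlgebra K S) V]

theorem tmul_single_smul (e : Idem S) (k : K) (x : θ.CrossedProduct) (v : V) :
    (x ⊗ₜ (MonoidAlgebra.single e.1 k • v) : θ.Induced V) = (x * (k • θ.gamma e.1)) ⊗ₜ v := by
  rw [← single_idem_smul, ← TensorProduct.smul_tmul, idem_smul_eq_mul, idemHom_single]

theorem smul_one_tmul (x : θ.CrossedProduct) (v : V) :
    x • (1 ⊗ₜ v : θ.Induced V) = x ⊗ₜ v := by
  rw [TensorProduct.smul_tmul', smul_eq_mul, mul_one]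

theorem hom_ext {P : Type*} [AddCommGroup P] [Module θ.CrossedProduct P]
    {f g : θ.Induced V →ₗ[θ.CrossedProduct] P} (h : ∀ v, f (1 ⊗ₜ v) = g (1 ⊗ₜ v)) : f = g := by
  ext w
  induction w using TensorProduct.induction_on with
  | zero => rw [_root_.map_zero, _root_.map_zero]
  | add w₁ w₂ h₁ h₂ => rw [_root_.map_add, _root_.map_add, h₁, h₂]
  | tmul x v => rw [← smul_one_tmul, _root_.map_smul, _root_.map_smul, h]

/-- Extension of scalars: an additive map `φ` that is linear over `K E(S)` extends to the
`A ⋊_θ S`-linear map `x ⊗ v ↦ x • φ v`. -/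
noncomputable def lift {P : Type*} [AddCommGroup P] [Module θ.CrossedProduct P] (φ : V →+ P)
    (hφ : ∀ (e : Idem S) (k : K) v,
      φ (MonoidAlgebra.single e.1 k • v) = (k • θ.gamma e.1) • φ v) :
    θ.Induced V →ₗ[θ.CrossedProduct] P where
  __ := TensorProduct.liftAddHom ((smulAddHom θ.CrossedProduct P).compl₂ φ) fun b x v => by
    change (x * θ.idemHom b) • φ v = x • φ (b • v)
    rw [mul_smul]
    congr 1
    induction b using MonoidAlgebra.induction_linear with
    | zero => simp only [_root_.map_zero, zero_smul]
    | add b c hb hc => simp only [_root_.map_add, add_smul, hb, hc]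
    | single e k => rw [idemHom_single, single_idem_smul, hφ]
  map_smul' x w := by
    simp only [ZeroHom.toFun_eq_coe, AddMonoidHom.toZeroHom_coe, RingHom.id_apply]
    induction w using TensorProduct.induction_on with
    | zero => simp only [smul_zero, _root_.map_zero]
    | add w₁ w₂ h₁ h₂ => simp only [smul_add, _root_.map_add, h₁, h₂]
    | tmul y v => exact mul_smul x y (φ v)

/-! ### The bimodule structure of an induced module -/

variable (V) in
/-- Right multiplication `x ⊗ v ↦ x a δ_1 ⊗ v`. -/
noncomputable def mulRightOfA (a : A) : Module.End θ.CrossedProduct (θ.Induced V) :=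
  lift θ (TensorProduct.mk (MonoidAlgebra K (Idem S)) θ.CrossedProduct V (θ.ofA a)).toAddMonoidHom
    fun e k v => by
      change θ.ofA a ⊗ₜ (MonoidAlgebra.single e.1 k • v) = (k • θ.gamma e.1) • θ.ofA a ⊗ₜ v
      rw [tmul_single_smul, TensorProduct.smul_tmul', smul_eq_mul, mul_smul_comm, smul_mul_assoc,
        gamma_idem_mul_ofA]

@[simp] theorem mulRightOfA_tmul (a : A) (x : θ.CrossedProduct) (v : V) :
    mulRightOfA θ V a (x ⊗ₜ v) = (x * θ.ofA a) ⊗ₜ v := rfl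

variable (V) in
/-- The twisted right multiplication `x ⊗ v ↦ x 1_s δ_s ⊗ s⁻¹ v`. -/
noncomputable def mulRightGamma (s : S) : Module.End θ.CrossedProduct (θ.Induced V) :=
  lift θ ((TensorProduct.mk (MonoidAlgebra K (Idem S)) θ.CrossedProduct V
      (θ.gamma s)).toAddMonoidHom.comp
        (DistribSMul.toAddMonoidHom V (MonoidAlgebra.single s⁻¹ (1 : K))))
    fun e k v => by
      change θ.gamma s ⊗ₜ (MonoidAlgebra.single s⁻¹ (1 : K) • MonoidAlgebra.single e.1 k • v) =
        (k • θ.gamma e.1) • θ.gamma s ⊗ₜ (MonoidAlgebra.single s⁻¹ (1 : K) • v)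
      have hcomm : MonoidAlgebra.single s⁻¹ (1 : K) * MonoidAlgebra.single e.1 k =
          MonoidAlgebra.single (conjIdem s⁻¹ e).1 k * MonoidAlgebra.single s⁻¹ (1 : K) := by
        rw [MonoidAlgebra.single_mul_single, MonoidAlgebra.single_mul_single, conjIdem_inv_mul_inv,
          one_mul, mul_one]
      rw [smul_smul, hcomm, mul_smul, tmul_single_smul, TensorProduct.smul_tmul', smul_eq_mul,
        mul_smul_comm, smul_mul_assoc, ← gamma_mul, ← gamma_mul, mul_conjIdem_inv]

@[simp] theorem mulRightGamma_tmul (s : S) (x : θ.CrossedProduct) (v : V) :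
    mulRightGamma θ V s (x ⊗ₜ v) =
      (x * θ.gamma s) ⊗ₜ (MonoidAlgebra.single s⁻¹ (1 : K) • v) := rfl

variable (V) in
/-- The right action of `A` on an induced module. -/
noncomputable def mulRightOfAHom : A →ₐ[K] (Module.End θ.CrossedProduct (θ.Induced V))ᵐᵒᵖ where
  toFun a := op (mulRightOfA θ V a)
  map_one' := unop_injective <| hom_ext θ fun v => by
    simp [← ofAHom_apply]
  map_mul' a b := unop_injective <| hom_ext θ fun v => by
    simp [ofA_mul]
  map_zero' := unop_injective <| hom_ext θ fun v => by
    simp [← ofAHom_apply]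
  map_add' a b := unop_injective <| hom_ext θ fun v => by
    simp [← ofAHom_apply, TensorProduct.add_tmul]
  commutes' k := unop_injective <| hom_ext θ fun v => by
    simp [← ofAHom_apply, Algebra.algebraMap_eq_smul_one, TensorProduct.smul_tmul']

variable (V) in
/-- The right action of `S` on an induced module. -/
noncomputable def mulRightGammaHom : S →* (Module.End θ.CrossedProduct (θ.Induced V))ᵐᵒᵖ where
  toFun s := op (mulRightGamma θ V s)
  map_one' := unop_injective <| hom_ext θ fun v => by
    simp [gamma_one, inv_one', ← MonoidAlgebra.one_def]
  map_mul' s t := unop_injective <| hom_ext θ fun v => by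
    simp [gamma_mul, mul_inv_rev', smul_smul, MonoidAlgebra.single_mul_single]

theorem mulRightGammaHom_mul_mulRightOfAHom (s : S) (a : A) :
    mulRightGammaHom θ V s * mulRightOfAHom θ V a =
      mulRightOfAHom θ V (θ.app s a) * mulRightGammaHom θ V s :=
  unop_injective <| hom_ext θ fun v => by
    simp [mulRightOfAHom, mulRightGammaHom, gamma_mul_ofA]

theorem mulRightOfAHom_unit (e : Idem S) :
    mulRightOfAHom θ V (θ.unit e.1) = mulRightGammaHom θ V e.1 :=
  unop_injective <| hom_ext θ fun v => by
    simp [mulRightOfAHom, mulRightGammaHom, inv_of_idem e.2, tmul_single_smul, ← gamma_mul,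
      e.2.eq, ← gamma_idem]

variable (V) in
/-- The right action of `A ⋊_θ S` on an induced module. -/
noncomputable def mulRight :
    θ.CrossedProduct →ₐ[K] (Module.End θ.CrossedProduct (θ.Induced V))ᵐᵒᵖ :=
  CrossedProduct.lift θ (D := (Module.End θ.CrossedProduct (θ.Induced V))ᵐᵒᵖ)
    (mulRightGammaHom_mul_mulRightOfAHom θ) (mulRightOfAHom_unit θ)

noncomputable instance : Module θ.CrossedProductᵐᵒᵖ (θ.Induced V) :=
  Module.compHom (θ.Induced V) (AlgHom.opComm (mulRight θ V)).toRingHom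

theorem op_smul_eq (x : θ.CrossedProduct) (w : θ.Induced V) :
    op x • w = unop (mulRight θ V x) w := rfl

instance : IsScalarTower K θ.CrossedProductᵐᵒᵖ (θ.Induced V) :=
  ⟨fun k x w => LinearMap.congr_fun
    (_root_.map_smul (AlgHom.opComm (mulRight θ V)) k x) w⟩

instance : SMulCommClass θ.CrossedProduct θ.CrossedProductᵐᵒᵖ (θ.Induced V) :=
  ⟨fun x y w => (_root_.map_smul (AlgHom.opComm (mulRight θ V) y) x w).symm⟩

@[simp] theorem op_ofA_smul_tmul (a : A) (x : θ.CrossedProduct) (v : V) :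
    op (θ.ofA a) • (x ⊗ₜ v : θ.Induced V) = (x * θ.ofA a) ⊗ₜ v := by
  rw [op_smul_eq, mulRight, CrossedProduct.lift_ofA]
  rfl

@[simp] theorem op_gamma_smul_tmul (s : S) (x : θ.CrossedProduct) (v : V) :
    op (θ.gamma s) • (x ⊗ₜ v : θ.Induced V) =
      (x * θ.gamma s) ⊗ₜ (MonoidAlgebra.single s⁻¹ (1 : K) • v) := by
  rw [op_smul_eq, mulRight, CrossedProduct.lift_gamma]
  rfl

end Induced

end Induced

end UnitalAction

namespace UnitalAction

open InverseMonoid MulOpposite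

attribute [local instance] TensorProduct.Algebra.module idemModuleOfModule

/-! ### Bimodule homomorphisms out of an induced module -/

section Bimodule

variable {K S A : Type*} [CommRing K] [InverseMonoid S] [Ring A] [Algebra K A]
  (θ : UnitalAction K S A)

/-- The enveloping algebra of `A ⋊_θ S`. -/
abbrev Env : Type _ := θ.CrossedProduct ⊗[K] θ.CrossedProductᵐᵒᵖ

theorem map_op_smul_of_generators {N P : Type*} [AddCommGroup N] [AddCommGroup P]
    [Module θ.CrossedProductᵐᵒᵖ N] [Module θ.CrossedProductᵐᵒᵖ P] {f : P →+ N}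
    (hofA : ∀ a x, f (op (θ.ofA a) • x) = op (θ.ofA a) • f x)
    (hgamma : ∀ s x, f (op (θ.gamma s) • x) = op (θ.gamma s) • f x)
    (y : θ.CrossedProductᵐᵒᵖ) (x : P) : f (y • x) = y • f x := by
  induction y using MulOpposite.rec' with
  | h y =>
  induction y using CrossedProduct.induction generalizing x with
  | ofA a => exact hofA a x
  | gamma s => exact hgamma s x
  | add y z hy hz => rw [op_add, add_smul, add_smul, _root_.map_add, hy, hz]
  | mul y z hy hz => rw [op_mul, mul_smul, mul_smul, hz, hy]

variable {N : Type*} [AddCommGroup N] [Module K N] [Module θ.CrossedProduct N]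
  [Module θ.CrossedProductᵐᵒᵖ N] [IsScalarTower K θ.CrossedProduct N]
  [IsScalarTower K θ.CrossedProductᵐᵒᵖ N]

theorem op_gamma_idem_smul_invariants (e : Idem S) (x : θ.invariants N) :
    op (θ.gamma e.1) • (x : N) = θ.gamma e.1 • (x : N) := by
  rw [gamma_idem, x.2]

variable [SMulCommClass θ.CrossedProduct θ.CrossedProductᵐᵒᵖ N]

theorem coe_single_smul_invariants (s : S) (k : K) (x : θ.invariants N) :
    ((MonoidAlgebra.single s k • x : θ.invariants N) : N) =
      k • θ.gamma s • op (θ.gamma s⁻¹) • (x : N) := by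
  change ((θ.invariantsRep N).asAlgebraHom (MonoidAlgebra.single s k) x : N) = _
  rw [Representation.asAlgebraHom_single]
  rfl

theorem coe_single_idem_smul_invariants (e : Idem S) (k : K) (x : θ.invariants N) :
    ((MonoidAlgebra.single e.1 k • x : θ.invariants N) : N) = (k • θ.gamma e.1) • (x : N) := by
  rw [coe_single_smul_invariants, inv_of_idem e.2, op_gamma_idem_smul_invariants, smul_smul,
    ← gamma_mul, e.2.eq, smul_assoc]

theorem gamma_smul_single_inv_smul_invariants (s : S) (x : θ.invariants N) :
    θ.gamma s • ((MonoidAlgebra.single s⁻¹ (1 : K) • x : θ.invariants N) : N) =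
      op (θ.gamma s) • (x : N) := by
  let e : Idem S := ⟨s * s⁻¹, idem_mul_inv s⟩
  calc θ.gamma s • ((MonoidAlgebra.single s⁻¹ (1 : K) • x : θ.invariants N) : N)
      = op (θ.gamma s) • θ.gamma e.1 • (x : N) := by
        rw [coe_single_smul_invariants, inv_inv', one_smul, smul_smul, ← gamma_mul, smul_comm]
    _ = op (θ.gamma s) • (x : N) := by
        rw [← op_gamma_idem_smul_invariants, smul_smul, ← op_mul, ← gamma_mul, mul_inv_mul]

variable {P : Type*} [AddCommGroup P] [Module K P] [Module θ.CrossedProduct P]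
  [Module θ.CrossedProductᵐᵒᵖ P] [IsScalarTower K θ.CrossedProduct P]
  [IsScalarTower K θ.CrossedProductᵐᵒᵖ P] [SMulCommClass θ.CrossedProduct θ.CrossedProductᵐᵒᵖ P]

/-- The map on invariants induced by a bimodule homomorphism. -/
noncomputable def mapInvariants (p : N →ₗ[θ.Env] P) :
    θ.invariants N →ₗ[MonoidAlgebra K S] θ.invariants P :=
  let φ : θ.invariants N →+ θ.invariants P :=
    { toFun := fun x => ⟨p x, fun a => by rw [← map_left_smul, x.2, map_right_smul]⟩
      map_zero' := Subtype.ext (_root_.map_zero p)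
      map_add' := fun x y => Subtype.ext (_root_.map_add p (x : N) y) }
  { φ with
    map_smul' := map_smul_of_map_single_smul φ fun s k x => Subtype.ext <| by
      rw [coe_single_smul_invariants]
      change p (MonoidAlgebra.single s k • x : θ.invariants N).1 =
        k • θ.gamma s • op (θ.gamma s⁻¹) • p (x : N)
      rw [coe_single_smul_invariants, ← smul_assoc, map_left_smul, map_right_smul, smul_assoc] }

namespace Induced

variable {θ} {V : Type*} [AddCommGroup V] [Module (MonoidAlgebra K S) V]

theorem env_hom_ext {f g : θ.Induced V →ₗ[θ.Env] N} (h : ∀ v, f (1 ⊗ₜ v) = g (1 ⊗ₜ v)) :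
    f = g := by
  ext w
  induction w using TensorProduct.induction_on with
  | zero => rw [_root_.map_zero, _root_.map_zero]
  | add w₁ w₂ h₁ h₂ => rw [_root_.map_add, _root_.map_add, h₁, h₂]
  | tmul x v =>
    rw [← smul_one_tmul, map_left_smul, map_left_smul, h]

variable (θ V) in
/-- The unit `v ↦ 1 ⊗ v` of the adjunction between induction and invariants. -/
noncomputable def unit : V →ₗ[MonoidAlgebra K S] θ.invariants (θ.Induced V) :=
  let φ : V →+ θ.invariants (θ.Induced V) :=
    { toFun := fun v => ⟨1 ⊗ₜ v, fun a => by rw [smul_one_tmul, op_ofA_smul_tmul, one_mul]⟩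
      map_zero' := Subtype.ext (TensorProduct.tmul_zero V 1)
      map_add' := fun v w => Subtype.ext (TensorProduct.tmul_add 1 v w) }
  { φ with
    map_smul' := map_smul_of_map_single_smul φ fun s k v => Subtype.ext <| by
      let e : Idem S := ⟨s * s⁻¹, idem_mul_inv s⟩
      have hs : MonoidAlgebra.single s k =
          MonoidAlgebra.single e.1 k * MonoidAlgebra.single s 1 := by
        rw [MonoidAlgebra.single_mul_single, mul_inv_mul, mul_one]
      rw [coe_single_smul_invariants]
      change 1 ⊗ₜ (MonoidAlgebra.single s k • v) =
        k • θ.gamma s • op (θ.gamma s⁻¹) • (1 ⊗ₜ v : θ.Induced V)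
      rw [op_gamma_smul_tmul, inv_inv', one_mul, TensorProduct.smul_tmul',
        TensorProduct.smul_tmul', smul_eq_mul, ← gamma_mul, hs, mul_smul, tmul_single_smul,
        one_mul] }

@[simp] theorem coe_unit (v : V) : (unit θ V v : θ.Induced V) = 1 ⊗ₜ v := rfl

/-- The restriction of a bimodule homomorphism to the generators `1 ⊗ v`. -/
noncomputable def toInvariants (f : θ.Induced V →ₗ[θ.Env] N) :
    V →ₗ[MonoidAlgebra K S] θ.invariants N :=
  θ.mapInvariants f ∘ₗ unit θ V

@[simp] theorem coe_toInvariants (f : θ.Induced V →ₗ[θ.Env] N) (v : V) :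
    (toInvariants f v : N) = f (1 ⊗ₜ v) := rfl

/-- The bimodule homomorphism `x ⊗ v ↦ x • g v` extending a map into the invariants. -/
noncomputable def ofInvariants (g : V →ₗ[MonoidAlgebra K S] θ.invariants N) :
    θ.Induced V →ₗ[θ.Env] N :=
  let f : θ.Induced V →ₗ[θ.CrossedProduct] N :=
    lift θ ((θ.invariants N).subtype.toAddMonoidHom.comp g.toAddMonoidHom) fun e k v => by
      change ((g (MonoidAlgebra.single e.1 k • v) : θ.invariants N) : N) = _ • (g v : N)
      rw [_root_.map_smul, coe_single_idem_smul_invariants]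
  have hf (x : θ.CrossedProduct) (v : V) : f (x ⊗ₜ v) = x • (g v : N) := rfl
  bimoduleHom f <| θ.map_op_smul_of_generators (f := f.toAddMonoidHom)
    (fun a w => by
      induction w using TensorProduct.induction_on with
      | zero => simp only [smul_zero, _root_.map_zero]
      | add w₁ w₂ h₁ h₂ => simp only [smul_add, _root_.map_add, h₁, h₂]
      | tmul x v =>
        change f (op (θ.ofA a) • x ⊗ₜ v) = op (θ.ofA a) • f (x ⊗ₜ v)
        rw [op_ofA_smul_tmul, hf, hf, mul_smul, (g v).2, smul_comm])
    (fun s w => by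
      induction w using TensorProduct.induction_on with
      | zero => simp only [smul_zero, _root_.map_zero]
      | add w₁ w₂ h₁ h₂ => simp only [smul_add, _root_.map_add, h₁, h₂]
      | tmul x v =>
        change f (op (θ.gamma s) • x ⊗ₜ v) = op (θ.gamma s) • f (x ⊗ₜ v)
        rw [op_gamma_smul_tmul, hf, hf, mul_smul, _root_.map_smul,
          gamma_smul_single_inv_smul_invariants, smul_comm])

@[simp] theorem ofInvariants_tmul (g : V →ₗ[MonoidAlgebra K S] θ.invariants N)
    (x : θ.CrossedProduct) (v : V) : ofInvariants g (x ⊗ₜ v) = x • (g v : N) := rfl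

/-- Induction is left adjoint to taking invariants. -/
noncomputable def homEquiv :
    (θ.Induced V →ₗ[θ.Env] N) ≃+ (V →ₗ[MonoidAlgebra K S] θ.invariants N) where
  toFun := toInvariants
  invFun := ofInvariants
  left_inv f := env_hom_ext fun v => by rw [ofInvariants_tmul, coe_toInvariants, one_smul]
  right_inv g := LinearMap.ext fun v => Subtype.ext <| by
    rw [coe_toInvariants, ofInvariants_tmul, one_smul]
  map_add' _ _ := rfl

end Induced

end Bimodule

end UnitalAction

namespace UnitalAction

open InverseMonoid MulOpposite

attribute [local instance] TensorProduct.Algebra.module idemModuleOfModule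

/-! ### Induction preserves projective modules over a separable algebra -/

section Projective

variable {K S A : Type*} [CommRing K] [InverseMonoid S] [Ring A] [Algebra K A]
  (θ : UnitalAction K S A) {N P : Type*} [AddCommGroup N] [Module K N]
  [Module θ.CrossedProduct N] [Module θ.CrossedProductᵐᵒᵖ N] [IsScalarTower K θ.CrossedProduct N]
  [IsScalarTower K θ.CrossedProductᵐᵒᵖ N] [SMulCommClass θ.CrossedProduct θ.CrossedProductᵐᵒᵖ N]
  [AddCommGroup P] [Module K P] [Module θ.CrossedProduct P] [Module θ.CrossedProductᵐᵒᵖ P]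
  [IsScalarTower K θ.CrossedProduct P] [IsScalarTower K θ.CrossedProductᵐᵒᵖ P]
  [SMulCommClass θ.CrossedProduct θ.CrossedProductᵐᵒᵖ P]

theorem surjective_mapInvariants (hA : IsSeparableAlgebra K A) (p : N →ₗ[θ.Env] P)
    (hp : Function.Surjective p) : Function.Surjective (θ.mapInvariants p) := fun y => by
  let ι : A ⊗[K] Aᵐᵒᵖ →ₐ[K] θ.Env := Algebra.TensorProduct.map θ.ofAHom (AlgHom.op θ.ofAHom)
  have left (a : A) : ι (a ⊗ₜ 1) = θ.ofA a ⊗ₜ 1 := by simp [ι, ← ofAHom_apply]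
  have right (a : A) : ι (1 ⊗ₜ op a) = 1 ⊗ₜ op (θ.ofA a) := by simp [ι, ← ofAHom_apply]
  let _ : Module (A ⊗[K] Aᵐᵒᵖ) N := Module.compHom N ι.toRingHom
  let _ : Module (A ⊗[K] Aᵐᵒᵖ) P := Module.compHom P ι.toRingHom
  let p' : N →ₗ[A ⊗[K] Aᵐᵒᵖ] P := { p.toAddHom with map_smul' := fun c => p.map_smul (ι c) }
  have hy (a : A) : ι (a ⊗ₜ 1) • (y : P) = ι (1 ⊗ₜ op a) • (y : P) := by
    rw [left, right, tmul_one_smul, one_tmul_smul, y.2]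
  obtain ⟨x, hx, hxy⟩ := hA.exists_central_lift p' hp hy
  refine ⟨⟨x, fun a => ?_⟩, Subtype.ext hxy⟩
  have hxa : ι (a ⊗ₜ 1) • x = ι (1 ⊗ₜ op a) • x := hx a
  rwa [left, right, tmul_one_smul, one_tmul_smul] at hxa

variable (V : Type*) [AddCommGroup V] [Module (MonoidAlgebra K S) V]
  [Module.Projective (MonoidAlgebra K S) V]

variable {V} in
theorem Induced.exists_comp_eq_id (hA : IsSeparableAlgebra K A) {N : Type*} [AddCommGroup N]
    {inst : Module θ.Env N} (p : N →ₗ[θ.Env] θ.Induced V) (hp : Function.Surjective p) :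
    ∃ h : θ.Induced V →ₗ[θ.Env] N, p ∘ₗ h = LinearMap.id := by
  obtain ⟨_, _, _, _, _, _, rfl⟩ := exists_bimodule_of_module_tensorProduct inst
  obtain ⟨g, hg⟩ := Module.projective_lifting_property (θ.mapInvariants p) (unit θ V)
    (θ.surjective_mapInvariants hA p hp)
  refine ⟨ofInvariants g, env_hom_ext fun v => ?_⟩
  rw [LinearMap.comp_apply, ofInvariants_tmul, one_smul]
  exact congrArg Subtype.val (LinearMap.congr_fun hg v)

theorem projective_induced (hA : IsSeparableAlgebra K A) :
    Module.Projective θ.Env (θ.Induced V) :=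
  .of_lifting_property'' fun p hp =>
    Induced.exists_comp_eq_id θ (N := θ.Induced V →₀ θ.Env) hA p hp

end Projective

/-! ### Exactness of induction -/

section Functoriality

variable {K S A : Type*} [CommRing K] [InverseMonoid S] [Ring A] [Algebra K A]
  (θ : UnitalAction K S A)

namespace Induced

variable {V W : Type*} [AddCommGroup V] [Module (MonoidAlgebra K S) V] [AddCommGroup W]
  [Module (MonoidAlgebra K S) W]

/-- Induction on homomorphisms: `x ⊗ v ↦ x ⊗ f v`. -/
noncomputable def map (f : V →ₗ[MonoidAlgebra K S] W) : θ.Induced V →ₗ[θ.Env] θ.Induced W :=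
  ofInvariants (unit θ W ∘ₗ f)

@[simp] theorem map_tmul (f : V →ₗ[MonoidAlgebra K S] W) (x : θ.CrossedProduct) (v : V) :
    map θ f (x ⊗ₜ v) = x ⊗ₜ f v := by
  rw [map, ofInvariants_tmul, LinearMap.comp_apply, coe_unit, smul_one_tmul]

/-- A `K S`-linear map regarded as a `K E(S)`-linear map. -/
def idemLinear (f : V →ₗ[MonoidAlgebra K S] W) : V →ₗ[MonoidAlgebra K (Idem S)] W where
  __ := f.toAddHom
  map_smul' b := f.map_smul (MonoidAlgebra.mapDomainRingHom K (idemIncl S) b)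

theorem coe_map (f : V →ₗ[MonoidAlgebra K S] W) :
    ⇑(map θ f) = (idemLinear f).lTensor θ.CrossedProduct := by
  funext w
  induction w using TensorProduct.induction_on with
  | zero => rw [_root_.map_zero, _root_.map_zero]
  | add w₁ w₂ h₁ h₂ => rw [_root_.map_add, _root_.map_add, h₁, h₂]
  | tmul x v => exact map_tmul θ f x v

end Induced

end Functoriality

theorem Induced.map_exact {K S A V W X : Type*} [Field K] [InverseMonoid S] [Ring A] [Algebra K A]
    (θ : UnitalAction K S A) [AddCommGroup V] [AddCommGroup W] [AddCommGroup X]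
    [Module (MonoidAlgebra K S) V] [Module (MonoidAlgebra K S) W] [Module (MonoidAlgebra K S) X]
    {f : V →ₗ[MonoidAlgebra K S] W} {g : W →ₗ[MonoidAlgebra K S] X} (h : Function.Exact f g) :
    Function.Exact (map θ f) (map θ g) := by
  have := flat_of_span_idempotents (span_isIdempotentElem_idemAlgebra (S := S) K) θ.CrossedProduct
  rw [coe_map, coe_map]
  exact Module.Flat.lTensor_exact (f := idemLinear f) (g := idemLinear g) θ.CrossedProduct h

/-! ### The module induced from `K E(S)` -/

section Self

variable {K S A : Type*} [CommRing K] [InverseMonoid S] [Ring A] [Algebra K A]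
  (θ : UnitalAction K S A)

theorem single_smul_single (s : S) (k l : K) (e : Idem S) :
    (MonoidAlgebra.single s k : MonoidAlgebra K S) • (Finsupp.single e l : Idem S →₀ K) =
      Finsupp.single (conjIdem s e) (k * l) := by
  change (idemRep S K).asAlgebraHom (MonoidAlgebra.single s k) _ = _
  rw [Representation.asAlgebraHom_single, LinearMap.smul_apply]
  change k • Finsupp.mapDomain _ _ = _
  rw [Finsupp.mapDomain_single, Finsupp.smul_single, smul_eq_mul]

/-- The `K S`-linear map `e ↦ 1_e δ_e` from `K E(S)` to the centralizer of `A`. -/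
noncomputable def gammaIdem : (Idem S →₀ K) →ₗ[MonoidAlgebra K S] θ.invariants θ.CrossedProduct :=
  let φ : (Idem S →₀ K) →ₗ[K] θ.invariants θ.CrossedProduct :=
    Finsupp.linearCombination K fun e => ⟨θ.gamma e.1, fun a => (θ.gamma_idem_mul_ofA e a).symm⟩
  { φ with
    map_smul' := map_smul_of_map_single_smul φ.toAddMonoidHom fun s k f => Subtype.ext <| by
      induction f using Finsupp.induction_linear with
      | zero => simp only [smul_zero, _root_.map_zero]
      | add f g hf hg => simp only [smul_add, _root_.map_add, Submodule.coe_add, hf, hg]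
      | single e l =>
        have hφ (e : Idem S) (l : K) : (φ (Finsupp.single e l) : θ.CrossedProduct) =
            l • θ.gamma e.1 := congrArg Subtype.val (Finsupp.linearCombination_single K l e)
        rw [coe_single_smul_invariants, single_smul_single]
        change (φ _ : θ.CrossedProduct) = k • (θ.gamma s * ((φ _ : θ.CrossedProduct) * θ.gamma s⁻¹))
        rw [hφ, hφ, smul_mul_assoc, mul_smul_comm, smul_smul, ← gamma_mul, ← gamma_mul, ← mul_assoc]
        rfl }

@[simp] theorem coe_gammaIdem_single (e : Idem S) (k : K) :
    (θ.gammaIdem (Finsupp.single e k) : θ.CrossedProduct) = k • θ.gamma e.1 :=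
  congrArg Subtype.val (Finsupp.linearCombination_single K k e)

theorem gammaIdem_tmul_single_one (f : Idem S →₀ K) :
    ((θ.gammaIdem f : θ.CrossedProduct) ⊗ₜ Finsupp.single 1 1 : θ.Induced (Idem S →₀ K)) =
      1 ⊗ₜ f := by
  induction f using Finsupp.induction_linear with
  | zero => simp
  | add f g hf hg =>
    rw [_root_.map_add, Submodule.coe_add, TensorProduct.add_tmul, hf, hg, TensorProduct.tmul_add]
  | single e k =>
    have hsingle : (Finsupp.single e k : Idem S →₀ K) =
        MonoidAlgebra.single e.1 k • Finsupp.single 1 1 := by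
      have he : conjIdem e.1 1 = e := Subtype.ext <| by
        change e.1 * 1 * e.1⁻¹ = e.1
        rw [mul_one, inv_of_idem e.2, e.2.eq]
      rw [single_smul_single, he, mul_one]
    rw [coe_gammaIdem_single, hsingle, Induced.tmul_single_smul, one_mul]

/-- The module induced from `K E(S)` is `A ⋊_θ S` itself. -/
noncomputable def Induced.equivSelf : θ.Induced (Idem S →₀ K) ≃ₗ[θ.Env] θ.CrossedProduct :=
  let F : θ.Induced (Idem S →₀ K) →ₗ[θ.Env] θ.CrossedProduct := ofInvariants θ.gammaIdem
  have leftInverse : Function.LeftInverse (fun x => x ⊗ₜ Finsupp.single 1 1) F := fun w => by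
    induction w using TensorProduct.induction_on with
    | zero => simp
    | add w₁ w₂ h₁ h₂ =>
      dsimp only at h₁ h₂ ⊢
      rw [_root_.map_add, TensorProduct.add_tmul, h₁, h₂]
    | tmul x f =>
      change (x • (θ.gammaIdem f : θ.CrossedProduct)) ⊗ₜ Finsupp.single 1 1 = x ⊗ₜ f
      rw [← TensorProduct.smul_tmul', gammaIdem_tmul_single_one, smul_one_tmul]
  have rightInverse (x : θ.CrossedProduct) : F (x ⊗ₜ Finsupp.single 1 1) = x := by
    change x * (θ.gammaIdem (Finsupp.single 1 1) : θ.CrossedProduct) = x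
    rw [coe_gammaIdem_single, one_smul]
    exact (congrArg (x * ·) θ.gamma_one).trans (mul_one x)
  LinearEquiv.ofBijective F ⟨leftInverse.injective, fun x => ⟨_, rightInverse x⟩⟩

end Self

end UnitalAction

open CategoryTheory

/-! ### Comparison of Ext groups along an exact functor preserving projectives -/

section ExtComparison

universe v

variable {K C D : Type*} [CommRing K] [Category.{v} C] [Category.{v} D] [Abelian C] [Abelian D]
  [Linear K C] [Linear K D] [EnoughProjectives C] [EnoughProjectives D]

/-- `Ext^n (F X, Y) ≅ Ext^n (X, Y')` for an exact functor `F` that preserves projective objects,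
if `Y'` represents `Hom (F -, Y)`. -/
noncomputable def extIsoOfHomEquiv (F : C ⥤ D) [F.Additive] [F.PreservesHomology]
    [F.PreservesProjectiveObjects] {Y : D} {Y' : C}
    (e : ∀ X, (F.obj X ⟶ Y) ≃ₗ[K] (X ⟶ Y'))
    (he : ∀ {X X' : C} (p : X ⟶ X') (f : F.obj X' ⟶ Y), e X (F.map p ≫ f) = p ≫ e X' f)
    (X : C) (n : ℕ) :
    ((Ext K D n).obj (.op (F.obj X))).obj Y ≅ ((Ext K C n).obj (.op X)).obj Y' :=
  let P := projectiveResolution X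
  let homComplexIso :
      ChainComplex.linearYonedaObj ((F.mapHomologicalComplex _).obj P.complex) K Y ≅
        P.complex.linearYonedaObj K Y' :=
    HomologicalComplex.Hom.isoOfComponents (fun i => (e (P.complex.X i)).toModuleIso)
      fun _ _ _ => ModuleCat.hom_ext (LinearMap.ext fun f => (he _ f).symm)
  (F.mapProjectiveResolution P).isoExt (R := K) n Y ≪≫
    (HomologicalComplex.homologyFunctor _ _ n).mapIso homComplexIso ≪≫
    (P.isoExt (R := K) n Y').symm

end ExtComparison

namespace UnitalAction

open InverseMonoid

attribute [local instance] TensorProduct.Algebra.module idemModuleOfModule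

/-! ### The induction functor -/

section Functor

variable {K S A : Type u} [CommRing K] [InverseMonoid S] [Ring A] [Algebra K A]
  (θ : UnitalAction K S A)

/-- Induction as a functor from left `K S`-modules to `A ⋊_θ S`-bimodules. -/
noncomputable def inducedFunctor : ModuleCat.{u} (MonoidAlgebra K S) ⥤ ModuleCat.{u} θ.Env where
  obj V := ModuleCat.of θ.Env (θ.Induced V)
  map f := ModuleCat.ofHom (Induced.map θ f.hom)
  map_id _ := ModuleCat.hom_ext (Induced.env_hom_ext fun v => Induced.map_tmul θ _ 1 v)
  map_comp f g := ModuleCat.hom_ext (Induced.env_hom_ext fun v => by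
    rw [ModuleCat.hom_ofHom, Induced.map_tmul, ModuleCat.hom_comp, LinearMap.comp_apply,
      ModuleCat.hom_comp, LinearMap.comp_apply, ModuleCat.hom_ofHom, ModuleCat.hom_ofHom,
      Induced.map_tmul, Induced.map_tmul])

instance : θ.inducedFunctor.Additive where
  map_add {V W f g} := ModuleCat.hom_ext (Induced.env_hom_ext (N := θ.Induced W) fun v => by
    change Induced.map θ (f + g).hom (1 ⊗ₜ v) =
      Induced.map θ f.hom (1 ⊗ₜ v) + Induced.map θ g.hom (1 ⊗ₜ v)
    rw [Induced.map_tmul, Induced.map_tmul, Induced.map_tmul, ModuleCat.hom_add,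
      LinearMap.add_apply, TensorProduct.tmul_add])

theorem preservesProjectiveObjects_inducedFunctor (hA : IsSeparableAlgebra K A) :
    θ.inducedFunctor.PreservesProjectiveObjects where
  projective_obj {V} hV := by
    have : Module.Projective (MonoidAlgebra K S) V := (IsProjective.iff_projective _).2 hV
    exact (IsProjective.iff_projective _).1 (θ.projective_induced V hA)

end Functor

section Adjunction

variable {K S A : Type u} [Field K] [InverseMonoid S] [Ring A] [Algebra K A]
  (θ : UnitalAction K S A)

instance : θ.inducedFunctor.PreservesHomology :=
  ((Functor.exact_tfae θ.inducedFunctor).out 1 2).1 fun X hX => by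
    rw [ShortComplex.ShortExact.moduleCat_exact_iff_function_exact] at hX ⊢
    exact Induced.map_exact θ hX

variable (M : Type u) [AddCommGroup M] [Module K M] [Module θ.CrossedProduct M]
  [Module θ.CrossedProductᵐᵒᵖ M] [IsScalarTower K θ.CrossedProduct M]
  [IsScalarTower K θ.CrossedProductᵐᵒᵖ M] [SMulCommClass θ.CrossedProduct θ.CrossedProductᵐᵒᵖ M]

/-- The adjunction between induction and invariants as a `K`-linear equivalence of morphism
spaces. -/
noncomputable def inducedFunctorHomEquiv (V : ModuleCat.{u} (MonoidAlgebra K S)) :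
    (θ.inducedFunctor.obj V ⟶ ModuleCat.of θ.Env M) ≃ₗ[K]
      (V ⟶ ModuleCat.of (MonoidAlgebra K S) (θ.invariants M)) where
  __ := ModuleCat.homAddEquiv.trans ((Induced.homEquiv (N := M)).trans
    (ModuleCat.homAddEquiv (N := ModuleCat.of (MonoidAlgebra K S) (θ.invariants M))).symm)
  map_smul' k f := ModuleCat.hom_ext (LinearMap.ext fun v => Subtype.ext <| by
    have algebraMap_env_smul (x : M) : algebraMap K θ.Env k • x = k • x := by
      rw [Algebra.TensorProduct.algebraMap_apply, tmul_one_smul, algebraMap_smul]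
    refine .trans ?_
      (θ.coe_single_smul_invariants 1 k (Induced.toInvariants (N := M) f.hom v)).symm
    rw [inv_one', gamma_one, MulOpposite.op_one, one_smul, one_smul]
    exact algebraMap_env_smul _)

theorem inducedFunctorHomEquiv_map_comp {V W : ModuleCat.{u} (MonoidAlgebra K S)} (p : V ⟶ W)
    (f : θ.inducedFunctor.obj W ⟶ ModuleCat.of θ.Env M) :
    θ.inducedFunctorHomEquiv M V (θ.inducedFunctor.map p ≫ f) =
      p ≫ θ.inducedFunctorHomEquiv M W f :=
  ModuleCat.hom_ext (LinearMap.ext fun v => Subtype.ext <|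
    congrArg f.hom (Induced.map_tmul θ p.hom 1 v))

end Adjunction

end UnitalAction

theorem mainTheorem10 {K S A : Type u} [Field K] [InverseMonoid S] [Ring A] [Algebra K A]
    (θ : UnitalAction K S A) (hA : IsSeparableAlgebra K A)
    (M : Type u) [AddCommGroup M] [Module K M] [Module θ.CrossedProduct M]
    [Module θ.CrossedProductᵐᵒᵖ M] [IsScalarTower K θ.CrossedProduct M]
    [IsScalarTower K θ.CrossedProductᵐᵒᵖ M]
    [SMulCommClass θ.CrossedProduct θ.CrossedProductᵐᵒᵖ M] (n : ℕ) :
    Nonempty (InverseMonoid.cohomology K S (θ.invariants M) n ≃ₗ[K]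
      hochschildCohomology K θ.CrossedProduct M n) := by
  let _ : Module θ.Env θ.CrossedProduct := TensorProduct.Algebra.module
  let _ : Module θ.Env M := TensorProduct.Algebra.module
  have := θ.preservesProjectiveObjects_inducedFunctor hA
  let kIdem := ModuleCat.of (MonoidAlgebra K S) (InverseMonoid.Idem S →₀ K)
  let adjunctionIso := extIsoOfHomEquiv θ.inducedFunctor (θ.inducedFunctorHomEquiv M)
    (θ.inducedFunctorHomEquiv_map_comp M) kIdem n
  let inducedIso : θ.inducedFunctor.obj kIdem ≅ ModuleCat.of θ.Env θ.CrossedProduct :=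
    (UnitalAction.Induced.equivSelf θ).toModuleIso
  let extInducedIso := ((Ext K (ModuleCat.{u} θ.Env) n).mapIso inducedIso.symm.op).app
    (ModuleCat.of θ.Env M)
  exact ⟨(adjunctionIso.symm ≪≫ extInducedIso).toLinearEquiv⟩
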